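/- **Theorem 3.1.** Let $G=GL(n;\mathbb C)$, let $0\le q\le p-1$ be integers, put $r=p-q$, and let $N\bar G(r)=G^{r+1}\ni(g_0,\dots,g_r)$. Let $\theta_i=g_i^{-1}dg_i$ $(0\le i\le r)$ be the pull-back of the Maurer–Cartan form along the $i$-th projection. Let $\Delta^r$ be the standard simplex with barycentric coordinates $t_0,\dots,t_r$ ($t_0=1-t_1-\dots-t_r$), oriented by $dt_1\wedge\dots\wedge dt_r$. On $\Delta^r\times N\bar G(r)$ consider the connection form $\theta=t_0\theta_0+\dots+t_r\theta_r$ and its curvature $\Omega=d\theta+\frac12[\theta,\theta]$. Then the form in $\Omega^{p+q}(N\bar G(p-q))$ corresponding to the $p$-th Chern character $\mathrm{ch}_p$, that is, the integral along $\Delta^{p-q}$ of the component of bidegree $(p-q,p+q)$ of $\frac1{p!}\mathrm{tr}\bigl((-\Omega/2\pi i)^p\bigr)$ (the factor $dt_1\wedge\dots\wedge dt_{p-q}$ being written in front), exists (the integrand is integrable over $\Delta^{p-q}$) and equals $$\frac1{p!}\Bigl(\frac1{2\pi i}\Bigr)^p(-1)^{(p-q)(p-q-1)/2}\;\mathrm{tr}\sum_{\sigma,f,c}\mathrm{sgn}(\sigma)\;\Bigl(p(\theta_0-\theta_1)\wedge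 \bar H_{\sigma,f,c}\Bigr)\int_{\Delta^{p-q}}\prod_{0\le i<j\le p-q}(t_it_j)^{a_{ij}(c)}\,dt_1\wedge\dots\wedge dt_{p-q}.$$ Here the sum is over all permutations $\sigma$ of $\{1,\dots,p-q-1\}$, all weakly increasing maps $f:\{1,\dots,q\}\to\{0,\dots,p-q-1\}$ and all maps $c$ from $\{1,\dots,q\}$ to the set of pairs $(i,j)$ with $0\le i<j\le p-q$. The form $\bar H_{\sigma,f,c}$ is obtained from the summand $$(\theta_{\sigma(1)}-\theta_{\sigma(1)+1})\cdots(\theta_{\sigma(p-q-1)}-\theta_{\sigma(p-q-1)+1})$$ of the alternating sum $$\bar S_{p-q}=\sum_{\sigma\in\mathfrak S_{p-q-1}}\mathrm{sgn}(\sigma)\,(\theta_{\sigma(1)}-\theta_{\sigma(1)+1})\cdots(\theta_{\sigma(p-q-1)}-\theta_{\sigma(p-q-1)+1})$$ by inserting $q$ factors: for $k=1,\dots,q$ in order, the factor $(\theta_i-\theta_j)^2$ with $(i,j)=c(k)$ is put into the gap number $f(k)$, where gap $0$ is the place before the first factor (directly after $\theta_0-\theta_1$), gap $s\ge 1$ is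 the place directly after the $s$-th factor, and several insertions may share a gap. Finally $a_{ij}(c)$ is the number of $k$ with $c(k)=(i,j)$. Products of matrix-valued forms are wedge products with matrix multiplication of the values. -/

import Mathlib

-- The norm on matrices is only used to speak of derivatives; all norms are equivalent.
open scoped Matrix.Norms.Operator

noncomputable section

namespace SimplicialChern

/-! ### Alternating forms on a real vector space and their wedge product -/

section Forms

variable {V A A' A'' : Type*} [AddCommGroup V] [Module ℝ V]
  [AddCommGroup A] [Module ℝ A] [AddCommGroup A'] [Module ℝ A'] [AddCommGroup A''] [Module ℝ A'']

/-- The wedge product of a `k`-form and an `l`-form along a bilinear pairing `B` of the values: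
the sum over `(k, l)`-shuffles `τ` of `sgn τ • B (ω (v_τ(1), …, v_τ(k))) (η (v_τ(k+1), …))`. -/
def wedgeAlong (B : A →ₗ[ℝ] A' →ₗ[ℝ] A'') {k l : ℕ}
    (ω : V [⋀^Fin k]→ₗ[ℝ] A) (η : V [⋀^Fin l]→ₗ[ℝ] A') : V [⋀^Fin (k + l)]→ₗ[ℝ] A'' :=
  ((TensorProduct.lift B).compAlternatingMap (ω.domCoprod η)).domDomCongr finSumFinEquiv

/-- Alternating forms of mixed degree on `V` with values in `A`; the entry at `k` is the
component of degree `k`. -/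
abbrev Forms (V A : Type*) [AddCommGroup V] [Module ℝ V] [AddCommGroup A] [Module ℝ A] : Type _ :=
  (k : ℕ) → V [⋀^Fin k]→ₗ[ℝ] A

/-- A form of degree `k`, viewed as a form of mixed degree. -/
def homog (k : ℕ) (ω : V [⋀^Fin k]→ₗ[ℝ] A) : Forms V A :=
  Pi.single (M := fun k : ℕ => V [⋀^Fin k]→ₗ[ℝ] A) k ω

end Forms

section Algebra

variable {V A : Type*} [AddCommGroup V] [Module ℝ V] [Ring A] [Algebra ℝ A]

/-- The wedge product of `A`-valued forms of mixed degree, the values being multiplied in `A`. -/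
def wedge (ω η : Forms V A) : Forms V A := fun k =>
  ∑ i : Fin (k + 1), (wedgeAlong (LinearMap.mul ℝ A) (ω i) (η (k - i))).domDomCongr
    (finCongr (Nat.add_sub_of_le (Nat.le_of_lt_succ i.2)))

/-- The constant `0`-form `1`. -/
def unitForm : Forms V A := homog 0 (AlternatingMap.constOfIsEmpty ℝ V (Fin 0) (1 : A))

/-- The wedge product of a list of forms, in the given order. -/
def wedgeProd (L : List (Forms V A)) : Forms V A := L.foldr wedge unitForm

/-- The `p`-th wedge power. -/
def wedgePow (ω : Forms V A) (p : ℕ) : Forms V A := wedgeProd (List.replicate p ω)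

end Algebra

/-- Complex `n × n` matrices: the Lie algebra of `GL(n, ℂ)` and the ambient space of the
open subset `GL(n, ℂ)`. -/
abbrev Mat (n : ℕ) : Type := Matrix (Fin n) (Fin n) ℂ

/-- The trace of a matrix-valued form. -/
def traceForm {n : ℕ} {V : Type*} [AddCommGroup V] [Module ℝ V] (ω : Forms V (Mat n)) :
    Forms V ℂ :=
  fun k => (Matrix.traceLinearMap (Fin n) ℝ ℂ).compAlternatingMap (ω k)

/-! ### The simplex and integration along it -/

/-- The simplex `Δ^r` in the coordinates `t_1, …, t_r`. -/
def simplex (r : ℕ) : Set (Fin r → ℝ) := {t | (∀ i, 0 ≤ t i) ∧ ∑ i, t i ≤ 1}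

/-- The barycentric coordinates `t_0 = 1 - t_1 - … - t_r, t_1, …, t_r`. -/
def bary {r : ℕ} (t : Fin r → ℝ) : Fin (r + 1) → ℝ := Fin.cons (1 - ∑ i, t i) t

/-- For a form `ω` on `Δ^r × X` and vectors `w_1, …, w_m` tangent to `X` at `x`, the function
`t ↦ ω_(t, x) (∂/∂t_1, …, ∂/∂t_r, w_1, …, w_m)`: the coefficient of `dt_1 ∧ … ∧ dt_r` (written in
front) in the component of `ω` of bidegree `(r, m)`, evaluated at `w_1, …, w_m`. -/
def simplexCoeff {r : ℕ} {X : Type*} [AddCommGroup X] [Module ℝ X]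
    (ω : (Fin r → ℝ) × X → Forms ((Fin r → ℝ) × X) ℂ) (m : ℕ) (x : X) (w : Fin m → X)
    (t : Fin r → ℝ) : ℂ :=
  ω (t, x) (r + m)
    (Fin.append (fun i : Fin r => ((Pi.single i 1, 0) : (Fin r → ℝ) × X)) (fun j => (0, w j)))

/-- Integration along `Δ^r`, oriented by `dt_1 ∧ … ∧ dt_r`, of the component of bidegree `(r, m)`
of a form on `Δ^r × X`: the value at `x` and `w_1, …, w_m` of the resulting `m`-form on `X`. -/
def integrateSimplex {r : ℕ} {X : Type*} [AddCommGroup X] [Module ℝ X]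
    (ω : (Fin r → ℝ) × X → Forms ((Fin r → ℝ) × X) ℂ) (m : ℕ) (x : X) (w : Fin m → X) : ℂ :=
  ∫ t in simplex r, simplexCoeff ω m x w t

/-! ### The canonical connection and its curvature -/

/-- The ambient vector space of the open subset `NḠ(r) = GL(n, ℂ)^(r+1)`; also its tangent space
at each point. -/
abbrev NBar (n r : ℕ) : Type := Fin (r + 1) → Mat n

/-- The (left invariant) Maurer-Cartan form `g⁻¹ dg` of `GL(n, ℂ)` at `g`. -/
def maurerCartan {n : ℕ} (g : Mat n) : Mat n →L[ℝ] Mat n := ContinuousLinearMap.mul ℝ (Mat n) g⁻¹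

/-- `θ_i`, the pull-back of the Maurer-Cartan form along the `i`-th projection of `NḠ(r)`. -/
def theta {n r : ℕ} (i : Fin (r + 1)) (g : NBar n r) : NBar n r →L[ℝ] Mat n :=
  (maurerCartan (g i)).comp (ContinuousLinearMap.proj i)

/-- The connection form `t_0 θ_0 + … + t_r θ_r` on `Δ^r × NḠ(r)`. -/
def connection (n r : ℕ) (x : (Fin r → ℝ) × NBar n r) :
    ((Fin r → ℝ) × NBar n r) [⋀^Fin 1]→L[ℝ] Mat n :=
  ContinuousAlternatingMap.ofSubsingleton ℝ _ _ (0 : Fin 1)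
    (∑ i, bary x.1 i • (theta i x.2).comp (ContinuousLinearMap.snd ℝ (Fin r → ℝ) (NBar n r)))

/-- The Lie bracket `(X, Y) ↦ X Y - Y X` of the Lie algebra of `GL(n, ℂ)`. -/
def commutator (n : ℕ) : Mat n →ₗ[ℝ] Mat n →ₗ[ℝ] Mat n :=
  LinearMap.mul ℝ (Mat n) - (LinearMap.mul ℝ (Mat n)).flip

/-- The curvature `Ω = dθ + (1/2) [θ, θ]` on `Δ^r × NḠ(r)`. -/
def curvature (n r : ℕ) (x : (Fin r → ℝ) × NBar n r) :
    ((Fin r → ℝ) × NBar n r) [⋀^Fin 2]→ₗ[ℝ] Mat n :=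
  (extDeriv (connection n r) x).toAlternatingMap +
    (1 / 2 : ℝ) • wedgeAlong (commutator n)
      (connection n r x).toAlternatingMap (connection n r x).toAlternatingMap

/-- The form `(1/p!) tr ((-Ω / 2πi)^p)` on `Δ^r × NḠ(r)`, representing the `p`-th Chern character. -/
def chernForm (n r p : ℕ) (x : (Fin r → ℝ) × NBar n r) : Forms ((Fin r → ℝ) × NBar n r) ℂ :=
  (1 / (p.factorial : ℂ)) •
    traceForm (wedgePow ((-1 / (2 * (Real.pi : ℂ) * Complex.I)) • homog 2 (curvature n r x)) p)

/-! ### The explicit formula -/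

/-- The one-form `θ_i - θ_j` on `NḠ(r)`. -/
def diffForm {n r : ℕ} (g : NBar n r) (i j : Fin (r + 1)) : Forms (NBar n r) (Mat n) :=
  homog 1 (AlternatingMap.ofSubsingleton ℝ _ _ (0 : Fin 1)
    (theta i g - theta j g : NBar n r →L[ℝ] Mat n).toLinearMap)

/-- The one-form `θ_a - θ_(a+1)` on `NḠ(r)`, for `0 ≤ a ≤ r - 1`. -/
def stepForm {n r : ℕ} (g : NBar n r) (a : Fin r) : Forms (NBar n r) (Mat n) :=
  diffForm g a.castSucc a.succ

/-- Pairs `(i, j)` with `0 ≤ i < j ≤ r`. -/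
abbrev Pairs (r : ℕ) : Type := {x : Fin (r + 1) × Fin (r + 1) // x.1 < x.2}

/-- The two-form `(θ_i - θ_j)²`. -/
def squareForm {n r : ℕ} (g : NBar n r) (x : Pairs r) : Forms (NBar n r) (Mat n) :=
  wedge (diffForm g x.1.1 x.1.2) (diffForm g x.1.1 x.1.2)

/-- The factors inserted into the gap number `a`, in order: the `(θ_i - θ_j)²` with `(i, j) = c k`,
for those `k` with `f k = a`. -/
def gapFactors {n r q : ℕ} (g : NBar n r) (f : Fin q → Fin r) (c : Fin q → Pairs r) (a : ℕ) :
    List (Forms (NBar n r) (Mat n)) :=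
  ((List.finRange q).filter (fun k => (f k : ℕ) = a)).map (fun k => squareForm g (c k))

/-- The product `(θ_σ(1) - θ_(σ(1)+1)) ⋯ (θ_σ(r-1) - θ_(σ(r-1)+1))`, in which the factors
`(θ_i - θ_j)²`, `(i, j) = c 1, …, c q`, have been inserted, the `k`-th one into the gap `f k`. Gap `0`
precedes the first factor, gap `s` follows the `s`-th one. The set `{1, …, r - 1}` permuted by `σ`
is `Fin (r - 1)` shifted by one. -/
def insertedProd {n r q : ℕ} (g : NBar n r) (σ : Equiv.Perm (Fin (r - 1)))
    (f : Fin q → Fin r) (c : Fin q → Pairs r) : Forms (NBar n r) (Mat n) :=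
  wedgeProd (gapFactors g f c 0 ++ (List.finRange (r - 1)).flatMap fun s =>
    stepForm g ⟨(σ s : ℕ) + 1, by omega⟩ :: gapFactors g f c ((s : ℕ) + 1))

/-- The number `a_ij` of insertions of `(θ_i - θ_j)²`. -/
def multiplicity {r q : ℕ} (c : Fin q → Pairs r) (x : Pairs r) : ℕ :=
  (Finset.univ.filter fun k => c k = x).card

/-- The integral over `Δ^r` of `∏_{i<j} (t_i t_j)^(a_ij) dt_1 ∧ … ∧ dt_r`. -/
def simplexIntegral {r q : ℕ} (c : Fin q → Pairs r) : ℝ :=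
  ∫ t in simplex r, ∏ x : Pairs r, (bary t x.1.1 * bary t x.1.2) ^ multiplicity c x

open Classical in
/-- The ways to distribute `q` insertions, in order, over the `r` gaps (repetitions allowed). -/
def placements (q r : ℕ) : Finset (Fin q → Fin r) := Finset.univ.filter fun f => Monotone f

end SimplicialChern

end

noncomputable section

namespace SimplicialChern

/-! ### From alternating forms to elements of `A ⊗ Λ(M)` -/

section Hat

open scoped TensorProduct

variable {V A A' A'' M : Type*} [AddCommGroup V] [Module ℝ V]
  [AddCommGroup A] [Module ℝ A] [AddCommGroup A'] [Module ℝ A'] [AddCommGroup A''] [Module ℝ A'']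
  [AddCommGroup M] [Module ℝ M]

/-! Fix a point `(t, g)` and the frame `∂/∂t_1, …, ∂/∂t_r, w_1, …, w_m`. Pulling matrix-valued forms
back along this frame turns wedge products into products in `Mat n ⊗ Λ(ℝ^(r+m))` (`hat_wedge`), and
the trace of the value on the frame into the trace of the top coefficient (`extTrace_hat`). The
coefficient of `dt_1 ∧ … ∧ dt_r` thus becomes a question of noncommutative algebra.

Put `ψ_a = θ_a - θ_(a+1)` and `y_a = dt_(a+1) + … + dt_r` for `0 ≤ a < r`. The Maurer-Cartan
equation, Abel summation and `∑ t_i = 1` give `-Ω = ∑ y_a ψ_a + ∑_{i<j} t_i t_j (θ_i - θ_j)²`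
(`hatDeg_two_of_curvature`).

In the `p`-th power only terms of degree `r` in the `dt` matter. A repeated `y_a` kills a term and
there are just `r` of them, so each `y_a ψ_a` occurs exactly once, among `q` squares. All factors
have even degree, so the trace is cyclic; bringing `y_0 ψ_0` to the front produces the factor `p`
(`extTrace_add_pow`). The rest is a sum over words (`add_pow_eq_sum_wordSum`), in which the other `r
- 1` letters appear in an order `σ`. Collecting the `y` in front of the `ψ` costs `(-1)^(r(r-1)/2)`,
sorting them costs `sgn σ` (`mul_wordSum_eq`), and `y_0 ⋯ y_(r-1) = dt_1 ⋯ dt_r` because the change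
of vectors is unitriangular (`ιMulti_tailSum`).

The resulting coefficients are polynomials in `t`, integrable on the compact simplex, and the finite
sum is integrated term by term (`integral_chernForm`). -/

theorem wedgeAlong_apply (B : A →ₗ[ℝ] A' →ₗ[ℝ] A'') {k l : ℕ}
    (ω : V [⋀^Fin k]→ₗ[ℝ] A) (η : V [⋀^Fin l]→ₗ[ℝ] A') (u : Fin (k + l) → V) :
    ((k.factorial * l.factorial : ℕ) : ℝ) • wedgeAlong B ω η u =
      ∑ π : Equiv.Perm (Fin k ⊕ Fin l), Equiv.Perm.sign π •
        B (ω fun i => u (finSumFinEquiv (π (.inl i)))) (η fun i => u (finSumFinEquiv (π (.inr i)))) := by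
  -- `domCoprod` sums over shuffles, that is, cosets; summing over the whole permutation group
  -- counts each shuffle `k! l!` times.
  have h := congrArg (fun F => TensorProduct.lift B (F (fun i => u (finSumFinEquiv i))))
    (MultilinearMap.domCoprod_alternization_eq ω η)
  simp only [Fintype.card_fin, AlternatingMap.smul_apply, map_nsmul,
    MultilinearMap.alternatization_apply, map_sum] at h
  rw [Nat.cast_smul_eq_nsmul]
  refine Eq.trans h.symm (Finset.sum_congr rfl fun π _ => ?_)
  rw [Units.smul_def, Units.smul_def, map_zsmul]
  simp [MultilinearMap.domDomCongr_apply, MultilinearMap.domCoprod_apply]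

/-- The element of `A ⊗ Λ(M)` obtained from a `k`-form by pulling it back along the linear map
sending the dual of `e j` to `v j`. -/
def hatDeg {N : ℕ} (v : Fin N → V) (e : Fin N → M) (k : ℕ) (ω : V [⋀^Fin k]→ₗ[ℝ] A) :
    A ⊗[ℝ] ExteriorAlgebra ℝ M :=
  (1 / (k.factorial : ℝ)) • ∑ f : Fin k → Fin N,
    ω (fun i => v (f i)) ⊗ₜ ExteriorAlgebra.ιMulti ℝ k (fun i => e (f i))

variable {N : ℕ} (v : Fin N → V) (e : Fin N → M)

theorem hatDeg_add (k : ℕ) (ω η : V [⋀^Fin k]→ₗ[ℝ] A) :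
    hatDeg v e k (ω + η) = hatDeg v e k ω + hatDeg v e k η := by
  simp [hatDeg, TensorProduct.add_tmul, Finset.sum_add_distrib]

theorem hatDeg_smul (k : ℕ) (c : ℝ) (ω : V [⋀^Fin k]→ₗ[ℝ] A) :
    hatDeg v e k (c • ω) = c • hatDeg v e k ω := by
  simp only [hatDeg, AlternatingMap.smul_apply, ← TensorProduct.smul_tmul', ← Finset.smul_sum]
  rw [smul_comm]

/-- Pigeonhole: more than `N` indices out of `N` repeat. This makes the truncation of `hat` at
degree `N` harmless. -/
theorem hatDeg_eq_zero {k : ℕ} (hk : N < k) (ω : V [⋀^Fin k]→ₗ[ℝ] A) : hatDeg v e k ω = 0 := by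
  unfold hatDeg
  rw [Finset.sum_eq_zero, smul_zero]
  intro f _
  have hf : ¬ Function.Injective f := fun h => by
    have := Fintype.card_le_of_injective f h
    simp at this; omega
  rw [ExteriorAlgebra.ιMulti_eq_zero_of_not_inj, TensorProduct.tmul_zero]
  exact fun h => hf (fun a b hab => h (by simp [hab]))

theorem hatDeg_domDomCongr {k l : ℕ} (h : k = l) (ω : V [⋀^Fin k]→ₗ[ℝ] A) :
    hatDeg v e l (ω.domDomCongr (finCongr h)) = hatDeg v e k ω := by
  subst h; rfl

theorem ιMulti_sum_split {k l : ℕ} (h : Fin k ⊕ Fin l → M) :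
    ExteriorAlgebra.ιMulti ℝ (k + l) (fun i => h (finSumFinEquiv.symm i)) =
      ExteriorAlgebra.ιMulti ℝ k (fun i => h (.inl i)) *
        ExteriorAlgebra.ιMulti ℝ l (fun i => h (.inr i)) := by
  rw [ExteriorAlgebra.ιMulti_mul_ιMulti]
  congr 1
  ext i
  refine Fin.addCases (fun i => ?_) (fun i => ?_) i <;> simp

theorem ιMulti_sum_perm {k l : ℕ} (h : Fin k ⊕ Fin l → M) (π : Equiv.Perm (Fin k ⊕ Fin l)) :
    ExteriorAlgebra.ιMulti ℝ (k + l) (fun i => h (π (finSumFinEquiv.symm i))) =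
      Equiv.Perm.sign π • ExteriorAlgebra.ιMulti ℝ (k + l) (fun i => h (finSumFinEquiv.symm i)) := by
  have := (ExteriorAlgebra.ιMulti ℝ (M := M) (k + l)).map_perm (fun i => h (finSumFinEquiv.symm i))
    ((finSumFinEquiv.symm.trans π).trans finSumFinEquiv)
  have h2 : Equiv.Perm.sign ((finSumFinEquiv.symm.trans π).trans finSumFinEquiv) =
    Equiv.Perm.sign π := Equiv.Perm.sign_symm_trans_trans π finSumFinEquiv
  rw [h2] at this
  rw [← this]
  congr 1
  ext i
  simp

end Hat

section HatMul

open scoped TensorProduct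

variable {V A M : Type*} [AddCommGroup V] [Module ℝ V] [Ring A] [Algebra ℝ A]
  [AddCommGroup M] [Module ℝ M] {N : ℕ} (v : Fin N → V) (e : Fin N → M)

/-- Permuting the arguments permutes the exterior monomial with the same sign, so after reindexing
all `(k+l)!` permutations contribute equally and cancel the normalisation of `hatDeg`. -/
theorem hatDeg_wedgeAlong {k l : ℕ} (ω : V [⋀^Fin k]→ₗ[ℝ] A) (η : V [⋀^Fin l]→ₗ[ℝ] A) :
    hatDeg v e (k + l) (wedgeAlong (LinearMap.mul ℝ A) ω η) = hatDeg v e k ω * hatDeg v e l η := by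
  set X : (Fin k ⊕ Fin l → Fin N) → A := fun h =>
    ω (fun i => v (h (.inl i))) * η (fun i => v (h (.inr i))) with hX
  set E : (Fin k ⊕ Fin l → Fin N) → ExteriorAlgebra ℝ M := fun h =>
    ExteriorAlgebra.ιMulti ℝ (k + l) (fun i => e (h (finSumFinEquiv.symm i))) with hE
  have hkl : ((k.factorial * l.factorial : ℕ) : ℝ) ≠ 0 := by positivity
  have hEp : ∀ h (π : Equiv.Perm (Fin k ⊕ Fin l)), E (h ∘ π) = Equiv.Perm.sign π • E h :=
    fun h π => ιMulti_sum_perm (fun i => e (h i)) π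
  have h1 : ∑ f : Fin (k + l) → Fin N,
      ((k.factorial * l.factorial : ℕ) : ℝ) • (wedgeAlong (LinearMap.mul ℝ A) ω η (fun i => v (f i))
        ⊗ₜ[ℝ] ExteriorAlgebra.ιMulti ℝ (k + l) (fun i => e (f i))) =
      ((k + l).factorial : ℝ) • ∑ h, X h ⊗ₜ[ℝ] E h := by
    rw [← (Equiv.arrowCongr finSumFinEquiv (Equiv.refl (Fin N))).sum_comp]
    have h2 : ∀ h : Fin k ⊕ Fin l → Fin N, ((k.factorial * l.factorial : ℕ) : ℝ) •
        (wedgeAlong (LinearMap.mul ℝ A) ω η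
            (fun i => v ((Equiv.arrowCongr finSumFinEquiv (Equiv.refl (Fin N))) h i))
          ⊗ₜ[ℝ] ExteriorAlgebra.ιMulti ℝ (k + l)
            (fun i => e ((Equiv.arrowCongr finSumFinEquiv (Equiv.refl (Fin N))) h i))) =
        ∑ π : Equiv.Perm (Fin k ⊕ Fin l), X (h ∘ π) ⊗ₜ[ℝ] E (h ∘ π) := by
      intro h
      rw [TensorProduct.smul_tmul', wedgeAlong_apply, TensorProduct.sum_tmul]
      refine Finset.sum_congr rfl fun π _ => ?_
      rw [hEp, Units.smul_def, Units.smul_def, TensorProduct.tmul_smul, TensorProduct.smul_tmul']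
      simp [hX, hE]
    rw [Finset.sum_congr rfl fun h _ => h2 h, Finset.sum_comm]
    have h3 : ∀ π : Equiv.Perm (Fin k ⊕ Fin l),
        ∑ h, X (h ∘ π) ⊗ₜ[ℝ] E (h ∘ π) = ∑ h, X h ⊗ₜ[ℝ] E h := fun π =>
      (Equiv.arrowCongr π.symm (Equiv.refl (Fin N))).sum_comp (fun h => X h ⊗ₜ[ℝ] E h)
    rw [Finset.sum_congr rfl fun π _ => h3 π, Finset.sum_const, Finset.card_univ,
      Fintype.card_perm, Fintype.card_sum, Fintype.card_fin, Fintype.card_fin,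
      Nat.cast_smul_eq_nsmul]
  have h4 : ∑ h, X h ⊗ₜ[ℝ] E h =
      (∑ f : Fin k → Fin N, ω (fun i => v (f i)) ⊗ₜ[ℝ]
        ExteriorAlgebra.ιMulti ℝ k (fun i => e (f i))) *
      ∑ f : Fin l → Fin N, η (fun i => v (f i)) ⊗ₜ[ℝ]
        ExteriorAlgebra.ιMulti ℝ l (fun i => e (f i)) := by
    rw [Finset.sum_mul_sum, ← Finset.sum_product', Finset.univ_product_univ,
      ← (Equiv.sumArrowEquivProdArrow (Fin k) (Fin l) (Fin N)).sum_comp]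
    refine Finset.sum_congr rfl fun h _ => ?_
    rw [Algebra.TensorProduct.tmul_mul_tmul]
    simp only [hX, hE, Equiv.sumArrowEquivProdArrow]
    rw [ιMulti_sum_split (fun i => e (h i))]
    rfl
  rw [← Finset.smul_sum, h4] at h1
  have h5 := congrArg (fun z => ((k.factorial * l.factorial : ℕ) : ℝ)⁻¹ • z) h1
  simp only [inv_smul_smul₀ hkl] at h5
  unfold hatDeg
  rw [h5, smul_mul_smul_comm, smul_smul, smul_smul]
  congr 1
  push_cast
  have : ((k + l).factorial : ℝ) ≠ 0 := by positivity
  field_simp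

/-- The element of `A ⊗ Λ(M)` obtained from a form of mixed degree. -/
def hat (ω : Forms V A) : A ⊗[ℝ] ExteriorAlgebra ℝ M :=
  ∑ k ∈ Finset.range (N + 1), hatDeg v e k (ω k)

theorem hat_homog (k : ℕ) (ω : V [⋀^Fin k]→ₗ[ℝ] A) : hat v e (homog k ω) = hatDeg v e k ω := by
  have h0 : ∀ j, hatDeg v e j (0 : V [⋀^Fin j]→ₗ[ℝ] A) = 0 := fun j => by simp [hatDeg]
  unfold hat
  by_cases hk : k ∈ Finset.range (N + 1)
  · rw [Finset.sum_eq_single_of_mem k hk]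
    · simp [homog]
    · intro j _ hj
      simp [homog, Pi.single_eq_of_ne hj, h0]
  · rw [hatDeg_eq_zero v e (by simpa using hk), Finset.sum_eq_zero]
    intro j hj
    have : j ≠ k := fun h => hk (h ▸ hj)
    simp [homog, Pi.single_eq_of_ne this, h0]

theorem hat_unitForm : hat v e (unitForm : Forms V A) = 1 := by
  rw [unitForm, hat_homog, hatDeg]
  simp [Algebra.TensorProduct.one_def]

theorem hat_smul (c : ℝ) (ω : Forms V A) : hat v e (c • ω) = c • hat v e ω := by
  simp [hat, hatDeg_smul, Finset.smul_sum]

theorem hat_wedge (ω η : Forms V A) : hat v e (wedge ω η) = hat v e ω * hat v e η := by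
  have h1 : ∀ k, hatDeg v e k (wedge ω η k) =
      ∑ x ∈ Finset.HasAntidiagonal.antidiagonal k, hatDeg v e x.1 (ω x.1) * hatDeg v e x.2 (η x.2) := by
    intro k
    have hlin : ∀ (s : Finset (Fin (k + 1))) (F : Fin (k + 1) → V [⋀^Fin k]→ₗ[ℝ] A),
        hatDeg v e k (∑ i ∈ s, F i) = ∑ i ∈ s, hatDeg v e k (F i) := fun s F =>
      map_sum (AddMonoidHom.mk' (hatDeg v e k) (hatDeg_add v e k)) F s
    rw [wedge, hlin, Finset.Nat.sum_antidiagonal_eq_sum_range_succ_mk, Finset.sum_range]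
    refine Finset.sum_congr rfl fun i _ => ?_
    rw [hatDeg_domDomCongr, hatDeg_wedgeAlong]
  unfold hat
  simp only [h1]
  rw [Finset.sum_mul_sum, ← Finset.sum_product', Finset.sum_sigma']
  refine Finset.sum_of_injOn (fun x => x.2) ?_ ?_ ?_ ?_
  · rintro ⟨k, x⟩ hx ⟨k', x'⟩ hx' h
    simp only [Finset.coe_sigma, Set.mem_sigma_iff, Finset.mem_coe,
      Finset.HasAntidiagonal.mem_antidiagonal] at hx hx'
    obtain rfl : x = x' := h
    obtain rfl : k = k' := hx.2.symm.trans hx'.2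
    rfl
  · rintro ⟨k, x⟩ hx
    simp at hx ⊢
    omega
  -- A pair of degrees outside the diagonals `k ≤ N` has total degree above `N`, where `hatDeg`
  -- vanishes.
  · rintro ⟨i, j⟩ hx hn
    rw [← hatDeg_wedgeAlong, hatDeg_eq_zero]
    by_contra hN
    exact hn ⟨⟨i + j, (i, j)⟩, by simp; omega, rfl⟩
  · intros; rfl

theorem hat_wedgeProd (L : List (Forms V A)) :
    hat v e (wedgeProd L) = (L.map (hat v e)).prod := by
  induction L with
  | nil => simpa [wedgeProd] using hat_unitForm v e
  | cons a L ih =>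
    have : wedgeProd (a :: L) = wedge a (wedgeProd L) := rfl
    rw [this, hat_wedge, ih, List.map_cons, List.prod_cons]

theorem hat_wedgePow (ω : Forms V A) (p : ℕ) : hat v e (wedgePow ω p) = hat v e ω ^ p := by
  simp [wedgePow, hat_wedgeProd]

/-- The element of `A ⊗ Λ(M)` obtained from a `1`-form. -/
def hatOne (α : V →ₗ[ℝ] A) : A ⊗[ℝ] ExteriorAlgebra ℝ M :=
  ∑ j, α (v j) ⊗ₜ ExteriorAlgebra.ι ℝ (e j)

theorem hat_oneForm (α : V →ₗ[ℝ] A) :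
    hat v e (homog 1 (AlternatingMap.ofSubsingleton ℝ _ _ (0 : Fin 1) α)) = hatOne v e α := by
  rw [hat_homog, hatDeg, hatOne, ← (Equiv.funUnique (Fin 1) (Fin N)).symm.sum_comp]
  simp [ExteriorAlgebra.ιMulti_apply]

/-- Brings a two-form known through its values on pairs of vectors into product form. The two halves
of the antisymmetrised value contribute equally, which cancels `1/2!`. -/
theorem hatDeg_two {ι : Type*} (s : Finset ι) (c : ι → ℝ) (α β : ι → V →ₗ[ℝ] A)
    (ω : V [⋀^Fin 2]→ₗ[ℝ] A)
    (h : ∀ a b, ω ![a, b] = ∑ i ∈ s, c i • (α i a * β i b - α i b * β i a)) :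
    hatDeg v e 2 ω = ∑ i ∈ s, c i • (hatOne v e (α i) * hatOne v e (β i)) := by
  have h2 : ∀ α β : V →ₗ[ℝ] A, ∑ x : Fin N × Fin N,
      (α (v x.1) * β (v x.2) - α (v x.2) * β (v x.1)) ⊗ₜ[ℝ]
        (ExteriorAlgebra.ι ℝ (e x.1) * ExteriorAlgebra.ι ℝ (e x.2)) =
      (2 : ℝ) • (hatOne v e α * hatOne v e β) := by
    intro α β
    have h3 : hatOne v e α * hatOne v e β = ∑ x : Fin N × Fin N,
        (α (v x.1) * β (v x.2)) ⊗ₜ[ℝ]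
          (ExteriorAlgebra.ι ℝ (e x.1) * ExteriorAlgebra.ι ℝ (e x.2)) := by
      rw [hatOne, hatOne, Finset.sum_mul_sum, ← Finset.sum_product', Finset.univ_product_univ]
      simp
    rw [two_smul]
    simp only [TensorProduct.sub_tmul, Finset.sum_sub_distrib]
    rw [← h3, sub_eq_add_neg]
    congr 1
    rw [h3, ← Finset.sum_neg_distrib, ← (Equiv.prodComm _ _).sum_comp]
    refine Finset.sum_congr rfl fun x _ => ?_
    rw [← TensorProduct.tmul_neg]
    congr 1
    exact neg_eq_of_add_eq_zero_left (ExteriorAlgebra.ι_add_mul_swap _ _)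
  have h4 : ∀ x : Fin N × Fin N, (fun i => v ((finTwoArrowEquiv (Fin N)).symm x i)) =
      ![v x.1, v x.2] := by
    intro x; ext i; fin_cases i <;> simp [finTwoArrowEquiv]
  rw [hatDeg, ← (finTwoArrowEquiv (Fin N)).symm.sum_comp]
  simp only [h4, h, TensorProduct.sum_tmul, ← TensorProduct.smul_tmul']
  rw [Finset.sum_comm, Finset.smul_sum]
  refine Finset.sum_congr rfl fun i _ => ?_
  have h5 := h2 (α i) (β i)
  rw [← Finset.smul_sum, smul_comm]
  congr 1
  rw [show ((1 : ℝ) / (Nat.factorial 2 : ℝ)) = 2⁻¹ by norm_num [Nat.factorial],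
    inv_smul_eq_iff₀ two_ne_zero, ← h5]
  refine Finset.sum_congr rfl fun x _ => ?_
  simp [ExteriorAlgebra.ιMulti_apply, finTwoArrowEquiv, Matrix.vecTail]

end HatMul

/-! ### The exterior derivative of the connection and the curvature -/

section Curvature

variable {n r : ℕ}

/-- The differentials of the barycentric coordinates. -/
def baryDiff (r : ℕ) (i : Fin (r + 1)) : (Fin r → ℝ) →L[ℝ] ℝ :=
  (Fin.cons (-∑ j, ContinuousLinearMap.proj j) fun j => ContinuousLinearMap.proj j :
    Fin (r + 1) → ((Fin r → ℝ) →L[ℝ] ℝ)) i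

theorem baryDiff_zero_apply (s : Fin r → ℝ) : baryDiff r 0 s = -∑ j, s j := by
  simp [baryDiff]

theorem baryDiff_succ_apply (i : Fin r) (s : Fin r → ℝ) : baryDiff r i.succ s = s i := by
  simp [baryDiff]

theorem hasFDerivAt_bary (i : Fin (r + 1)) (t : Fin r → ℝ) :
    HasFDerivAt (fun t => bary t i) (baryDiff r i) t := by
  have h : (fun t : Fin r → ℝ => bary t i) = fun t => bary 0 i + baryDiff r i t := by
    funext t
    refine Fin.cases ?_ (fun j => ?_) i
    · simp [bary, baryDiff_zero_apply, sub_eq_add_neg]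
    · simp [bary, baryDiff_succ_apply]
  rw [h]
  exact (baryDiff r i).hasFDerivAt.const_add _

section NormedAlgebra

variable {𝔸 : Type*} [NormedRing 𝔸] [NormedAlgebra ℝ 𝔸] (inv : 𝔸 → 𝔸)

/-- The Maurer-Cartan form of the unit group of a normed algebra, for a given inversion map,
pulled back along the `i`-th projection. -/
def thetaAlg (i : Fin (r + 1)) (g : Fin (r + 1) → 𝔸) :
    (Fin r → ℝ) × (Fin (r + 1) → 𝔸) →L[ℝ] 𝔸 :=
  ((ContinuousLinearMap.mul ℝ 𝔸 (inv (g i))).comp (ContinuousLinearMap.proj i)).comp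
    (ContinuousLinearMap.snd ℝ (Fin r → ℝ) (Fin (r + 1) → 𝔸))

/-- The canonical connection in a normed algebra. -/
def connectionAlg (x : (Fin r → ℝ) × (Fin (r + 1) → 𝔸)) :
    ((Fin r → ℝ) × (Fin (r + 1) → 𝔸)) [⋀^Fin 1]→L[ℝ] 𝔸 :=
  ContinuousAlternatingMap.ofSubsingleton ℝ _ _ (0 : Fin 1)
    (∑ i, bary x.1 i • thetaAlg inv i x.2)

variable {inv}

/-- Product rule. As inversion has derivative `a ↦ -g⁻¹ a g⁻¹`, differentiating `g⁻¹ dg` along `a`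
gives `-θ(a) θ`, the source of the Maurer-Cartan equation. -/
theorem hasFDerivAt_thetaAlg (i : Fin (r + 1)) {g : Fin (r + 1) → 𝔸}
    (hg : HasFDerivAt inv (-ContinuousLinearMap.mulLeftRight ℝ 𝔸 (inv (g i)) (inv (g i))) (g i))
    (t : Fin r → ℝ) :
    ∃ L : (Fin r → ℝ) × (Fin (r + 1) → 𝔸) →L[ℝ] ((Fin r → ℝ) × (Fin (r + 1) → 𝔸) →L[ℝ] 𝔸),
      HasFDerivAt (fun x : (Fin r → ℝ) × (Fin (r + 1) → 𝔸) => bary x.1 i • thetaAlg inv i x.2) L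
        (t, g) ∧
      ∀ a b, L a b = baryDiff r i a.1 • thetaAlg inv i g b -
        bary t i • (thetaAlg inv i g a * thetaAlg inv i g b) := by
  have h1 : HasFDerivAt (fun x : (Fin r → ℝ) × (Fin (r + 1) → 𝔸) => bary x.1 i)
      ((baryDiff r i).comp (ContinuousLinearMap.fst ℝ _ _)) (t, g) :=
    HasFDerivAt.comp (g := fun t => bary t i)
      (f := fun x : (Fin r → ℝ) × (Fin (r + 1) → 𝔸) => x.1)
      (t, g) (hasFDerivAt_bary i t) hasFDerivAt_fst
  have h2 : HasFDerivAt (fun x : (Fin r → ℝ) × (Fin (r + 1) → 𝔸) => x.2 i)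
      ((ContinuousLinearMap.proj i).comp (ContinuousLinearMap.snd ℝ _ _)) (t, g) :=
    ((ContinuousLinearMap.proj (R := ℝ) (φ := fun _ : Fin (r + 1) => 𝔸) i).comp
      (ContinuousLinearMap.snd ℝ (Fin r → ℝ) (Fin (r + 1) → 𝔸))).hasFDerivAt
  have h3 := HasFDerivAt.comp (g := inv)
    (f := fun x : (Fin r → ℝ) × (Fin (r + 1) → 𝔸) => x.2 i) (t, g) hg h2
  have h4 := (ContinuousLinearMap.mul ℝ 𝔸).hasFDerivAt.comp (t, g) h3
  have h5 := (h4.clm_comp (hasFDerivAt_const (ContinuousLinearMap.proj (R := ℝ)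
    (φ := fun _ : Fin (r + 1) => 𝔸) i) (t, g))).clm_comp
      (hasFDerivAt_const (ContinuousLinearMap.snd ℝ (Fin r → ℝ) (Fin (r + 1) → 𝔸)) (t, g))
  refine ⟨_, h1.smul h5, fun a b => ?_⟩
  simp [thetaAlg, sub_eq_neg_add, mul_assoc]

theorem extDeriv_connectionAlg {g : Fin (r + 1) → 𝔸}
    (hg : ∀ i, HasFDerivAt inv
      (-ContinuousLinearMap.mulLeftRight ℝ 𝔸 (inv (g i)) (inv (g i))) (g i))
    (t : Fin r → ℝ) (a b : (Fin r → ℝ) × (Fin (r + 1) → 𝔸)) :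
    extDeriv (connectionAlg inv) (t, g) ![a, b] =
      ∑ i, (baryDiff r i a.1 • thetaAlg inv i g b - baryDiff r i b.1 • thetaAlg inv i g a) -
      ∑ i, bary t i •
        (thetaAlg inv i g a * thetaAlg inv i g b - thetaAlg inv i g b * thetaAlg inv i g a) := by
  choose L hL hLa using fun i => hasFDerivAt_thetaAlg i (hg i) t
  have h1 : HasFDerivAt (fun x : (Fin r → ℝ) × (Fin (r + 1) → 𝔸) =>
      ∑ i, bary x.1 i • thetaAlg inv i x.2) (∑ i, L i) (t, g) :=
    have := @HasFDerivAt.fun_sum ℝ _ ((Fin r → ℝ) × (Fin (r + 1) → 𝔸)) _ _ ((Fin r → ℝ) × (Fin (r + 1) → 𝔸) →L[ℝ] 𝔸) _ _ (t,g) (Fin (r+1)) Finset.univ (fun i x => bary x.1 i • thetaAlg inv i x.2) L (fun i _ => hL i)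
    this
  have h2 := (ContinuousAlternatingMap.ofSubsingletonLIE (𝕜 := ℝ)
    (E := (Fin r → ℝ) × (Fin (r + 1) → 𝔸))
    (F := 𝔸) (0 : Fin 1)).toContinuousLinearEquiv.hasFDerivAt.comp _ h1
  have h3 : fderiv ℝ (connectionAlg inv) (t, g) = _ := h2.fderiv
  rw [extDeriv, h3, ContinuousAlternatingMap.alternatizeUncurryFin_apply, Fin.sum_univ_two]
  simp [hLa, Fin.removeNth, ContinuousAlternatingMap.ofSubsingletonLIE, smul_sub,
    Finset.sum_sub_distrib]
  abel

end NormedAlgebra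

theorem hasFDerivAt_matrix_inv (a : GL (Fin n) ℂ) :
    HasFDerivAt (fun x : Mat n => x⁻¹)
      (-ContinuousLinearMap.mulLeftRight ℝ (Mat n) ((a : Mat n)⁻¹) ((a : Mat n)⁻¹)) (a : Mat n) := by
  have h := hasFDerivAt_ringInverse (𝕜 := ℝ) (R := Mat n) a
  have h2 : (fun x : Mat n => x⁻¹) = Ring.inverse := by
    funext x
    rw [Matrix.nonsing_inv_eq_ringInverse]
  rw [h2, ← Matrix.coe_units_inv]
  exact h

/-- The pull-back of `θ_i` to `Δ^r × NḠ(r)`. -/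
def thetaProd (i : Fin (r + 1)) (g : NBar n r) : (Fin r → ℝ) × NBar n r →ₗ[ℝ] Mat n :=
  (theta i g).toLinearMap ∘ₗ LinearMap.snd ℝ (Fin r → ℝ) (NBar n r)

theorem extDeriv_connection (g : Fin (r + 1) → GL (Fin n) ℂ) (t : Fin r → ℝ)
    (a b : (Fin r → ℝ) × NBar n r) :
    extDeriv (connection n r) (t, fun i => (g i : Mat n)) ![a, b] =
      ∑ i, (baryDiff r i a.1 • thetaProd i (fun i => (g i : Mat n)) b -
        baryDiff r i b.1 • thetaProd i (fun i => (g i : Mat n)) a) -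
      ∑ i, bary t i • (thetaProd i (fun i => (g i : Mat n)) a * thetaProd i (fun i => (g i : Mat n)) b -
        thetaProd i (fun i => (g i : Mat n)) b * thetaProd i (fun i => (g i : Mat n)) a) :=
  extDeriv_connectionAlg (𝔸 := Mat n) (inv := fun x => x⁻¹)
    (fun i => hasFDerivAt_matrix_inv (g i)) t a b

theorem connection_apply (x : (Fin r → ℝ) × NBar n r) (u : (Fin r → ℝ) × NBar n r) :
    (connection n r x).toAlternatingMap ![u] = ∑ i, bary x.1 i • thetaProd i x.2 u := by
  change (∑ i, bary x.1 i • (theta i x.2).comp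
    (ContinuousLinearMap.snd ℝ (Fin r → ℝ) (NBar n r))) u = _
  simp [thetaProd]

theorem wedgeAlong_one_one {A A' A'' V : Type*} [AddCommGroup V] [Module ℝ V]
    [AddCommGroup A] [Module ℝ A] [AddCommGroup A'] [Module ℝ A'] [AddCommGroup A''] [Module ℝ A'']
    (B : A →ₗ[ℝ] A' →ₗ[ℝ] A'') (ω : V [⋀^Fin 1]→ₗ[ℝ] A) (η : V [⋀^Fin 1]→ₗ[ℝ] A') (a b : V) :
    wedgeAlong B ω η ![a, b] = B (ω ![a]) (η ![b]) - B (ω ![b]) (η ![a]) := by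
  have h := wedgeAlong_apply B ω η ![a, b]
  simp only [Nat.factorial_one, mul_one, Nat.cast_one, one_smul] at h
  have hu : (Finset.univ : Finset (Equiv.Perm (Fin 1 ⊕ Fin 1))) =
      {1, Equiv.swap (.inl 0) (.inr 0)} := by decide
  have e1 : ∀ x : V, (fun _ : Fin 1 => x) = ![x] := fun x => by ext i; fin_cases i; rfl
  have e2 : ∀ i : Fin 1, i = 0 := fun i => Subsingleton.elim _ _
  have e3 : (1 : Equiv.Perm (Fin 1 ⊕ Fin 1)) ≠ Equiv.swap (.inl 0) (.inr 0) := by decide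
  rw [h, hu, Finset.sum_pair e3]
  simp [e2, e1, sub_eq_add_neg, finSumFinEquiv]

theorem curvature_apply (g : Fin (r + 1) → GL (Fin n) ℂ) (t : Fin r → ℝ)
    (a b : (Fin r → ℝ) × NBar n r) :
    curvature n r (t, fun i => (g i : Mat n)) ![a, b] =
      ∑ i, (baryDiff r i a.1 • thetaProd i (fun i => (g i : Mat n)) b -
        baryDiff r i b.1 • thetaProd i (fun i => (g i : Mat n)) a) -
      ∑ i, bary t i • (thetaProd i (fun i => (g i : Mat n)) a * thetaProd i (fun i => (g i : Mat n)) b -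
        thetaProd i (fun i => (g i : Mat n)) b * thetaProd i (fun i => (g i : Mat n)) a) +
      ((∑ i, bary t i • thetaProd i (fun i => (g i : Mat n)) a) *
          (∑ i, bary t i • thetaProd i (fun i => (g i : Mat n)) b) -
        (∑ i, bary t i • thetaProd i (fun i => (g i : Mat n)) b) *
          (∑ i, bary t i • thetaProd i (fun i => (g i : Mat n)) a)) := by
  -- The commutator pairing of a one-form with itself yields twice the commutator of its values,
  -- which absorbs the factor `1/2`.
  have h3 : (1 / 2 : ℝ) • wedgeAlong (commutator n)
      (connection n r (t, fun i => (g i : Mat n))).toAlternatingMap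
      (connection n r (t, fun i => (g i : Mat n))).toAlternatingMap ![a, b] =
      ((∑ i, bary t i • thetaProd i (fun i => (g i : Mat n)) a) *
          (∑ i, bary t i • thetaProd i (fun i => (g i : Mat n)) b) -
        (∑ i, bary t i • thetaProd i (fun i => (g i : Mat n)) b) *
          (∑ i, bary t i • thetaProd i (fun i => (g i : Mat n)) a)) := by
    rw [wedgeAlong_one_one]
    rw [connection_apply, connection_apply, commutator]
    simp only [LinearMap.sub_apply, LinearMap.mul_apply', LinearMap.flip_apply]
    module
  rw [← extDeriv_connection, ← h3]
  rfl

end Curvature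

/-! ### Words in two kinds of letters and the noncommutative binomial formula -/

section Words

/-- The word in letters `s : Fin k` and `j : Fin q` in which the letters of `Fin k` occur in
order and the letter `j : Fin q` is put into the gap number `f j`. -/
def placementWord {k q : ℕ} (f : Fin q → Fin (k + 1)) : List (Fin k ⊕ Fin q) :=
  ((List.finRange q).filter fun j => (f j : ℕ) = 0).map Sum.inr ++
    (List.finRange k).flatMap fun s : Fin k =>
      Sum.inl s :: ((List.finRange q).filter fun j => (f j : ℕ) = (s : ℕ) + 1).map Sum.inr

theorem mem_placementWord {k q : ℕ} (f : Fin q → Fin (k + 1)) (x : Fin k ⊕ Fin q) :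
    x ∈ placementWord f := by
  rcases x with s | j
  · simp [placementWord]
  · simp only [placementWord, List.mem_append, List.mem_map, List.mem_filter, List.mem_finRange,
      List.mem_flatMap, List.mem_cons]
    rcases h : f j with ⟨_ | a, ha⟩
    · exact .inl ⟨j, by simp [h], rfl⟩
    · exact .inr ⟨⟨a, by omega⟩, trivial, .inr ⟨j, by simp [h], rfl⟩⟩

theorem nodup_placementWord {k q : ℕ} (f : Fin q → Fin (k + 1)) : (placementWord f).Nodup := by
  have hg : ∀ a : ℕ, (((List.finRange q).filter fun j => (f j : ℕ) = a).map
      (Sum.inr : Fin q → Fin k ⊕ Fin q)).Nodup := fun a =>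
    ((List.nodup_finRange q).filter _).map Sum.inr_injective
  refine List.Nodup.append (hg 0) ?_ ?_
  · rw [List.nodup_flatMap]
    refine ⟨fun s _ => List.nodup_cons.2 ⟨by simp, hg _⟩, ?_⟩
    refine (List.nodup_finRange k).pairwise_of_forall_ne fun s _ s' _ hs => ?_
    intro x hx hx'
    simp only [List.mem_cons, List.mem_map, List.mem_filter, List.mem_finRange, true_and,
      decide_eq_true_eq] at hx hx'
    rcases hx with rfl | ⟨j, hj, rfl⟩
    · simp at hx'
      exact hs hx'
    · simp at hx'
      exact hs (Fin.ext (by omega))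
  · intro x hx hx'
    simp only [List.mem_cons, List.mem_map, List.mem_filter, List.mem_finRange, true_and,
      decide_eq_true_eq, List.mem_flatMap] at hx hx'
    obtain ⟨j, hj, rfl⟩ := hx
    obtain ⟨s, hs⟩ := hx'
    simp at hs
    omega

theorem filterMap_getLeft_placementWord {k q : ℕ} (f : Fin q → Fin (k + 1)) :
    (placementWord f).filterMap Sum.getLeft? = List.finRange k := by
  have h : ∀ l : List (Fin q),
      (l.map (Sum.inr : Fin q → Fin k ⊕ Fin q)).filterMap Sum.getLeft? = [] := by
    intro l; induction l <;> simp_all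
  have h2 : ∀ l : List (Fin k), (l.flatMap fun s : Fin k =>
      Sum.inl s :: ((List.finRange q).filter fun j => (f j : ℕ) = (s : ℕ) + 1).map
        Sum.inr).filterMap Sum.getLeft? = l := by
    intro l
    induction l with
    | nil => rfl
    | cons s l ih =>
      rw [List.flatMap_cons, List.filterMap_append, ih, List.filterMap_cons]
      simp [h]
  rw [placementWord, List.filterMap_append, h, h2, List.nil_append]

variable {R : Type*} [Ring R]

/-- The index type for the choice of a summand at a letter of a word. -/
abbrev LetterChoice (κ P : Type) {k q : ℕ} : Fin k ⊕ Fin q → Type :=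
  Sum.elim (fun _ => κ) (fun _ => P)

instance {κ P : Type} [Fintype κ] [Fintype P] {k q : ℕ} :
    ∀ i : Fin k ⊕ Fin q, Fintype (LetterChoice κ P i)
  | .inl _ => ‹Fintype κ›
  | .inr _ => ‹Fintype P›

/-- Each index occurs exactly once in `l`, so the product along `l` is a multilinear map of the
family of letters, and the sums expand independently at every index. -/
theorem prod_map_sum_sum [Algebra ℝ R] {k q : ℕ} {l : List (Fin k ⊕ Fin q)} (hl : l.Nodup) (hm : ∀ x, x ∈ l)
    {κ P : Type} [Fintype κ] [Fintype P] (X : κ → R) (u : P → ℝ) (Y : P → R) :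
    (l.map (Sum.elim (fun _ => ∑ a, X a) (fun _ => ∑ x, u x • Y x))).prod =
      ∑ τ : Fin k → κ, ∑ c : Fin q → P, (∏ j, u (c j)) •
        (l.map (Sum.elim (fun s => X (τ s)) (fun j => Y (c j)))).prod := by
  classical
  let F : MultilinearMap ℝ (fun _ : Fin k ⊕ Fin q => R) R :=
    (MultilinearMap.mkPiAlgebraFin ℝ l.length R).domDomCongr (hl.getEquivOfForallMemList l hm)
  have hF : ∀ x, F x = (l.map x).prod := by
    intro x
    simp only [F, MultilinearMap.domDomCongr_apply, MultilinearMap.mkPiAlgebraFin_apply]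
    congr 1
    conv_rhs => rw [← List.ofFn_get l]
    simp only [List.map_ofFn]
    rfl
  let g : ∀ i : Fin k ⊕ Fin q, LetterChoice κ P i → R := fun i => match i with
    | .inl _ => fun a : κ => X a
    | .inr _ => fun x : P => u x • Y x
  have h1 := F.map_sum g
  have h2 : (fun i => ∑ j, g i j) =
      Sum.elim (fun _ => ∑ a, X a) (fun _ => ∑ x, u x • Y x) := by
    funext i
    rcases i with i | i
    · rfl
    · rfl
  rw [← hF, ← h2, h1, ← (Equiv.sumPiEquivProdPi (LetterChoice κ P)).symm.sum_comp, Fintype.sum_prod_type]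
  refine Finset.sum_congr rfl fun τ _ => Finset.sum_congr rfl fun c _ => ?_
  have h3 : (∏ i : Fin k ⊕ Fin q, Sum.elim (fun _ => (1 : ℝ)) (fun j => u (c j)) i) =
      ∏ j, u (c j) := by simp
  rw [← h3, ← hF, ← F.map_smul_univ]
  congr 1
  funext i
  rcases i with i | i
  · exact (one_smul ℝ _).symm
  · rfl

theorem mul_list_prod_anticomm {ι : Type*} {ψ : R} {y : ι → R} (h : ∀ i, ψ * y i = -(y i * ψ))
    (l : List ι) : ψ * (l.map y).prod = (-1) ^ l.length * ((l.map y).prod * ψ) := by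
  induction l with
  | nil => simp
  | cons i l ih =>
    rw [List.map_cons, List.prod_cons, ← mul_assoc, h, neg_mul, mul_assoc, ih, List.length_cons,
      pow_succ]
    simp only [mul_neg, mul_one, neg_mul, mul_assoc, neg_inj]
    rw [← mul_assoc, ← mul_assoc ((-1) ^ l.length)]
    rw [((Commute.neg_one_left (y i)).pow_left l.length).eq]

theorem mul_list_prod_comm {ι : Type*} {b : R} {y : ι → R} (h : ∀ i, b * y i = y i * b)
    (l : List ι) : b * (l.map y).prod = (l.map y).prod * b := by
  have : Commute b (l.map y).prod := Commute.list_prod_right _ _ (by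
    simp only [List.mem_map]; rintro _ ⟨i, _, rfl⟩; exact h i)
  exact this.eq

/-- The leading `ψ` must pass all the `m` vectors `y` of the remaining word, at the cost of
`(-1)^m`; the factors `b` pass freely. Adding up these exponents gives the triangular number. -/
theorem prod_pull_front {K E : Type*} {y ψ : K → R} {b : E → R}
    (hψ : ∀ i j, ψ i * y j = -(y j * ψ i)) (hb : ∀ i j, b i * y j = y j * b i)
    (l : List (K ⊕ E)) :
    (l.map (Sum.elim (fun i => y i * ψ i) b)).prod =
      (-1) ^ ((l.filterMap Sum.getLeft?).length * ((l.filterMap Sum.getLeft?).length - 1) / 2) *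
        (((l.filterMap Sum.getLeft?).map y).prod * (l.map (Sum.elim ψ b)).prod) := by
  induction l with
  | nil => simp
  | cons x l ih =>
    have hc : ∀ (z : R) (n : ℕ), z * (-1) ^ n = (-1) ^ n * z := fun z n =>
      ((Commute.neg_one_right z).pow_right n).eq
    rcases x with i | j
    · rw [List.map_cons, List.prod_cons, ih, List.filterMap_cons]
      simp only [Sum.getLeft?_inl, List.length_cons, List.map_cons, List.prod_cons, Sum.elim_inl]
      set m := (l.filterMap Sum.getLeft?).length
      have hm : (m + 1) * (m + 1 - 1) / 2 = m * (m - 1) / 2 + m := Nat.triangle_succ m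
      rw [hm, pow_add, ← mul_assoc, hc, mul_assoc, mul_assoc, mul_assoc]
      congr 1
      rw [← mul_assoc (ψ i), mul_list_prod_anticomm (hψ i)]
      change y i * ((-1) ^ m * _ * _) = _
      rw [mul_assoc, ← mul_assoc (y i), hc]
      simp only [mul_assoc]
    · rw [List.map_cons, List.prod_cons, ih, List.filterMap_cons]
      simp only [Sum.getLeft?_inr, List.map_cons, List.prod_cons, Sum.elim_inr]
      rw [← mul_assoc, hc, mul_assoc, ← mul_assoc (b j), mul_list_prod_comm (hb j), mul_assoc]

/-- The sum of all words with `k` letters `a` and `q` letters `b`. -/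
def wordSum (k q : ℕ) (a b : R) : R :=
  ∑ f ∈ placements q (k + 1),
    ((placementWord f).map (Sum.elim (fun _ => a) (fun _ => b))).prod

/-- The number of letters put into the gap number `i`. -/
def gapCount {k q : ℕ} (f : Fin q → Fin (k + 1)) (i : ℕ) : ℕ :=
  ∑ j, if (f j : ℕ) = i then 1 else 0

theorem prod_placementWord {k q : ℕ} (f : Fin q → Fin (k + 1)) (a b : R) :
    ((placementWord f).map (Sum.elim (fun _ => a) (fun _ => b))).prod =
      b ^ gapCount f 0 * (List.ofFn fun s : Fin k => a * b ^ gapCount f (s + 1)).prod := by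
  have h : ∀ i : ℕ, ((((List.finRange q).filter fun j => (f j : ℕ) = i).map
      (Sum.inr : Fin q → Fin k ⊕ Fin q)).map (Sum.elim (fun _ => a) (fun _ => b))).prod =
      b ^ gapCount f i := by
    intro i
    rw [List.map_map]
    have h1 : (Sum.elim (fun _ => a) (fun _ => b) ∘ (Sum.inr : Fin q → Fin k ⊕ Fin q)) =
      fun _ => b := rfl
    rw [h1, List.map_const', List.prod_replicate, gapCount, Finset.sum_boole]
    congr 1
  rw [placementWord, List.map_append, List.prod_append, h, List.map_flatMap, List.ofFn_eq_map]
  congr 1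
  generalize List.finRange k = l
  induction l with
  | nil => rfl
  | cons s l ih =>
    rw [List.flatMap_cons, List.prod_append, ih, List.map_cons, List.prod_cons, h, List.map_cons,
      List.prod_cons]
    rfl

theorem placements_subsingleton_domain (k : ℕ) (f : Fin 0 → Fin k) :
    placements 0 k = {f} := by
  ext g
  simp [placements, Subsingleton.monotone, Subsingleton.elim g f, eq_iff_true_of_subsingleton]

theorem wordSum_zero_right (k : ℕ) (a b : R) : wordSum k 0 a b = a ^ k := by
  rw [wordSum, placements_subsingleton_domain _ Fin.elim0, Finset.sum_singleton,
    prod_placementWord]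
  simp [gapCount]

theorem wordSum_zero_left (q : ℕ) (a b : R) : wordSum 0 q a b = b ^ q := by
  have : placements q 1 = {fun _ => 0} := by
    ext g
    have : g = fun _ => 0 := by ext; simp
    simp [placements, this, monotone_const]
  rw [wordSum, this, Finset.sum_singleton, prod_placementWord]
  simp [gapCount]

/-- Words are split by their first letter. For monotone `f` the value `f 0` is the least one, so the
word begins with `b` exactly when `f 0 = 0`. -/
theorem wordSum_succ_succ (k q : ℕ) (a b : R) :
    wordSum (k + 1) (q + 1) a b = a * wordSum k (q + 1) a b + b * wordSum (k + 1) q a b := by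
  classical
  have h1 : ∑ f ∈ (placements (q + 1) (k + 1 + 1)).filter (fun f => f 0 = 0),
      ((placementWord f).map (Sum.elim (fun _ => a) (fun _ => b))).prod =
      b * wordSum (k + 1) q a b := by
    rw [wordSum, Finset.mul_sum]
    refine Finset.sum_nbij' (fun f => Fin.tail f) (fun f => Fin.cons 0 f) ?_ ?_ ?_ ?_ ?_
    · intro f hf
      simp only [placements, Finset.mem_filter, Finset.mem_univ, true_and] at hf ⊢
      exact fun i j hij => hf.1 (Fin.succ_le_succ_iff.2 hij)
    · intro f hf
      simp only [placements, Finset.mem_filter, Finset.mem_univ, true_and] at hf ⊢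
      refine ⟨fun i j => ?_, rfl⟩
      refine Fin.cases ?_ (fun i => ?_) i
      · simp
      · refine Fin.cases ?_ (fun j => ?_) j
        · simp
        · intro hij
          simpa using hf (Fin.succ_le_succ_iff.1 hij)
    · intro f hf
      simp only [Finset.mem_filter] at hf
      rw [← hf.2]
      exact Fin.cons_self_tail f
    · intro f _
      exact Fin.tail_cons _ _
    · intro f hf
      simp only [Finset.mem_filter] at hf
      have h2 : ∀ i : ℕ, gapCount f i = (if i = 0 then 1 else 0) + gapCount (Fin.tail f) i := by
        intro i
        rw [gapCount, Fin.sum_univ_succ, hf.2]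
        simp [gapCount, Fin.tail, eq_comm]
      rw [prod_placementWord, prod_placementWord]
      simp only [h2]
      simp [pow_add, mul_assoc]
  -- Here gap `0` is empty, so the word begins with `a`; removing that letter lowers every gap
  -- number by one.
  have h2 : ∑ f ∈ (placements (q + 1) (k + 1 + 1)).filter (fun f => ¬ f 0 = 0),
      ((placementWord f).map (Sum.elim (fun _ => a) (fun _ => b))).prod =
      a * wordSum k (q + 1) a b := by
    rw [wordSum, Finset.mul_sum]
    symm
    refine Finset.sum_bij (fun f _ => fun i => (f i).succ) ?_ ?_ ?_ ?_
    · intro f hf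
      simp only [placements, Finset.mem_filter, Finset.mem_univ, true_and] at hf ⊢
      exact ⟨fun i j hij => Fin.succ_le_succ_iff.2 (hf hij), Fin.succ_ne_zero _⟩
    · intro f _ f' _ h
      funext i
      exact Fin.succ_injective _ (congrFun h i)
    · intro f hf
      simp only [placements, Finset.mem_filter, Finset.mem_univ, true_and] at hf ⊢
      have h0 : ∀ i, f i ≠ 0 := fun i hi => hf.2 (le_antisymm (hi ▸ hf.1 (Fin.zero_le i)) (Fin.zero_le _))
      refine ⟨fun i => (f i).pred (h0 i), fun i j hij => ?_, by simp⟩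
      exact Fin.pred_le_pred_iff.2 (hf.1 hij)
    · intro f hf
      rw [prod_placementWord, prod_placementWord]
      have h3 : gapCount (fun i => (f i).succ) 0 = 0 := by simp [gapCount]
      have h4 : ∀ i, gapCount (fun i => (f i).succ) (i + 1) = gapCount f i := by
        intro i; simp [gapCount]
      simp [h3, h4, List.ofFn_succ, mul_assoc]
  rw [← h1, ← h2, add_comm (∑ f ∈ _ with ¬ _, _), Finset.sum_filter_add_sum_filter_not]
  rfl

/-- Induction by the Pascal recursion `wordSum_succ_succ`; words in a single letter are the boundary
cases. -/
theorem add_pow_eq_sum_wordSum (a b : R) (N : ℕ) :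
    (a + b) ^ N = ∑ x ∈ Finset.HasAntidiagonal.antidiagonal N, wordSum x.1 x.2 a b := by
  induction N with
  | zero => simp [wordSum_zero_right]
  | succ N ih =>
    rw [pow_succ', ih, add_mul, Finset.mul_sum, Finset.mul_sum, Finset.Nat.sum_antidiagonal_succ]
    rcases N with _ | N
    · simp [wordSum_zero_right, wordSum_zero_left, add_comm]
    · rw [Finset.Nat.sum_antidiagonal_succ' (f := fun x => wordSum (x.1 + 1) x.2 a b),
        Finset.Nat.sum_antidiagonal_succ' (f := fun x => a * wordSum x.1 x.2 a b),
        Finset.Nat.sum_antidiagonal_succ (f := fun x => b * wordSum x.1 x.2 a b)]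
      simp only [wordSum_succ_succ, Finset.sum_add_distrib, wordSum_zero_right, wordSum_zero_left,
        ← pow_succ']
      abel

end Words

/-! ### Signs and relations in the exterior algebra -/

section Exterior

open scoped TensorProduct

variable {A M V : Type*} [Ring A] [Algebra ℝ A] [AddCommGroup M] [Module ℝ M]
  [AddCommGroup V] [Module ℝ V]

theorem ι_mul_ι_comm (x y : M) :
    ExteriorAlgebra.ι ℝ x * ExteriorAlgebra.ι ℝ y =
      -(ExteriorAlgebra.ι ℝ y * ExteriorAlgebra.ι ℝ x) :=
  eq_neg_of_add_eq_zero_left (ExteriorAlgebra.ι_add_mul_swap x y)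

theorem commute_ι_mul_ι (x y : M) (u : ExteriorAlgebra ℝ M) :
    Commute (ExteriorAlgebra.ι ℝ x * ExteriorAlgebra.ι ℝ y) u := by
  induction u using ExteriorAlgebra.induction with
  | algebraMap c => exact Algebra.commutes' _ _ |>.symm
  | ι z =>
    change _ = _
    rw [mul_assoc, ι_mul_ι_comm y z, mul_neg, ← mul_assoc, ι_mul_ι_comm x z, neg_mul, neg_neg,
      mul_assoc]
  | mul a b ha hb => exact ha.mul_right hb
  | add a b ha hb => exact ha.add_right hb

/-- A vector moves to the left past generators with a sign, and hence past everything after a twist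
of `u`. This gives `x u x = 0` in `extOne_mul_mul_extOne`. -/
theorem exists_mul_ι_eq_ι_mul (x : M) (u : ExteriorAlgebra ℝ M) :
    ∃ u', u * ExteriorAlgebra.ι ℝ x = ExteriorAlgebra.ι ℝ x * u' := by
  induction u using ExteriorAlgebra.induction with
  | algebraMap c => exact ⟨algebraMap ℝ _ c, Algebra.commutes _ _⟩
  | ι z => exact ⟨-ExteriorAlgebra.ι ℝ z, by rw [ι_mul_ι_comm, mul_neg]⟩
  | mul a b ha hb =>
    obtain ⟨a', ha⟩ := ha
    obtain ⟨b', hb⟩ := hb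
    exact ⟨a' * b', by rw [mul_assoc, hb, ← mul_assoc, ha, mul_assoc]⟩
  | add a b ha hb =>
    obtain ⟨a', ha⟩ := ha
    obtain ⟨b', hb⟩ := hb
    exact ⟨a' + b', by rw [add_mul, ha, hb, mul_add]⟩

variable (A) in
/-- A vector of `M`, as an element of `A ⊗ Λ(M)`. -/
def extOne (x : M) : A ⊗[ℝ] ExteriorAlgebra ℝ M := 1 ⊗ₜ ExteriorAlgebra.ι ℝ x

theorem extOne_sum {ι : Type*} (s : Finset ι) (x : ι → M) :
    extOne A (∑ i ∈ s, x i) = ∑ i ∈ s, extOne A (x i) := by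
  simp [extOne, TensorProduct.tmul_sum]

theorem hatOne_mul_extOne {N : ℕ} (v : Fin N → V) (e : Fin N → M) (α : V →ₗ[ℝ] A) (x : M) :
    hatOne v e α * extOne A x = -(extOne A x * hatOne v e α) := by
  simp only [hatOne, extOne, Finset.sum_mul, Finset.mul_sum, Algebra.TensorProduct.tmul_mul_tmul,
    mul_one, one_mul, ← Finset.sum_neg_distrib]
  refine Finset.sum_congr rfl fun j _ => ?_
  rw [ι_mul_ι_comm, TensorProduct.tmul_neg]

theorem extOne_mul_mul_extOne (x : M) (z : A ⊗[ℝ] ExteriorAlgebra ℝ M) :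
    extOne A x * z * extOne A x = 0 := by
  induction z using TensorProduct.induction_on with
  | zero => simp
  | tmul a u =>
    obtain ⟨u', hu⟩ := exists_mul_ι_eq_ι_mul x u
    rw [mul_assoc, extOne, Algebra.TensorProduct.tmul_mul_tmul, Algebra.TensorProduct.tmul_mul_tmul,
      hu, ← mul_assoc (ExteriorAlgebra.ι ℝ x), ExteriorAlgebra.ι_sq_zero, zero_mul, TensorProduct.tmul_zero]
  | add z z' hz hz' => rw [mul_add, add_mul, hz, hz', add_zero]

theorem prod_map_extOne {k : ℕ} (x : Fin k → M) :
    ((List.finRange k).map fun i => extOne A (x i)).prod =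
      1 ⊗ₜ ExteriorAlgebra.ιMulti ℝ k x := by
  rw [ExteriorAlgebra.ιMulti_apply, ← List.ofFn_eq_map]
  induction k with
  | zero => simp [Algebra.TensorProduct.one_def]
  | succ k ih =>
    rw [List.ofFn_succ, List.ofFn_succ, List.prod_cons, List.prod_cons, ih]
    simp [extOne]

/-- The change of vectors is unitriangular. By induction the product of the later tail sums is that
of the later `x_l`, which annihilates everything but `x_0` in the first factor. -/
theorem ιMulti_tailSum {k : ℕ} (x : Fin k → M) :
    ExteriorAlgebra.ιMulti ℝ k (fun a => ∑ l, if a ≤ l then x l else 0) =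
      ExteriorAlgebra.ιMulti ℝ k x := by
  induction k with
  | zero => congr 1; ext i; exact i.elim0
  | succ k ih =>
    rw [ExteriorAlgebra.ιMulti_succ_apply, ExteriorAlgebra.ιMulti_succ_apply]
    have h := ih (Matrix.vecTail x)
    have h2 : (Matrix.vecTail fun a => ∑ l, if a ≤ l then x l else 0) =
        fun a => ∑ l, if a ≤ l then Matrix.vecTail x l else 0 := by
      funext a
      simp [Matrix.vecTail, Fin.sum_univ_succ]
    rw [h2, h, Fin.sum_univ_succ]
    simp only [Fin.zero_le, if_true, map_add, map_sum, add_mul, Finset.sum_mul]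
    rw [add_eq_left]
    refine Finset.sum_eq_zero fun i _ => ?_
    rw [ExteriorAlgebra.ιMulti_apply]
    exact ExteriorAlgebra.ι_mul_prod_list (Matrix.vecTail x) i

end Exterior

/-! ### Algebraic identities for the curvature and its powers -/

section Identities

/-- Abel summation: `θ_0 - θ_(l+1)` telescopes into consecutive differences. -/
theorem sum_mul_sub_eq_tailSum {R : Type*} [Ring R] {r : ℕ} (x : Fin r → R) (θ : Fin (r + 1) → R) :
    ∑ l, x l * (θ 0 - θ l.succ) =
      ∑ a : Fin r, (∑ l, if a ≤ l then x l else 0) * (θ a.castSucc - θ a.succ) := by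
  induction r with
  | zero => simp
  | succ r ih =>
    have h := ih (fun l => x l.succ) (fun i => θ i.succ)
    rw [Fin.sum_univ_succ, Fin.sum_univ_succ (n := r) (f := fun a : Fin (r + 1) =>
      (∑ l, if a ≤ l then x l else 0) * (θ a.castSucc - θ a.succ))]
    simp only [Fin.sum_univ_succ (n := r), Fin.zero_le, if_true, Fin.succ_le_succ_iff,
      Fin.castSucc_zero, ← Fin.succ_castSucc, Fin.le_zero_iff,
      Fin.succ_ne_zero, if_false, zero_add]
    rw [← h, add_mul, Finset.sum_mul, add_assoc (x 0 * _), ← Finset.sum_add_distrib]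
    congr 1
    refine Finset.sum_congr rfl fun l _ => ?_
    rw [← mul_add]
    congr 1
    simp

/-- The variance identity for weights of sum `1`, with noncommuting values. The sum over all ordered
pairs counts each `i < j` twice and has zero diagonal; expanding the squares gives twice the
right-hand side. -/
theorem sum_pairs_sq {R : Type*} [Ring R] [Algebra ℝ R] {r : ℕ} (t : Fin (r + 1) → ℝ)
    (ht : ∑ i, t i = 1) (θ : Fin (r + 1) → R) :
    ∑ x : Pairs r, (t x.1.1 * t x.1.2) • ((θ x.1.1 - θ x.1.2) * (θ x.1.1 - θ x.1.2)) =
      ∑ i, t i • (θ i * θ i) - (∑ i, t i • θ i) * ∑ i, t i • θ i := by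
  set F : Fin (r + 1) × Fin (r + 1) → R := fun x =>
    (t x.1 * t x.2) • ((θ x.1 - θ x.2) * (θ x.1 - θ x.2)) with hF
  have hsymm : ∀ x, F x.swap = F x := fun x => by
    simp only [hF, Prod.fst_swap, Prod.snd_swap]
    rw [mul_comm (t x.2), ← neg_sub (θ x.1), neg_mul_neg]
  have h1 : ∑ x : Pairs r, F x.1 = ∑ x with x.1 < x.2, F x :=
    (Finset.sum_subtype (p := fun x : Fin (r + 1) × Fin (r + 1) => x.1 < x.2) _ (by simp) F).symm
  have h2 : ∑ x with x.2 < x.1, F x = ∑ x with x.1 < x.2, F x := by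
    refine Finset.sum_nbij' Prod.swap Prod.swap ?_ ?_ ?_ ?_ ?_ <;> simp [hsymm]
  have h3 : ∑ x, F x = ∑ x with x.1 < x.2, F x + ∑ x with x.2 < x.1, F x := by
    rw [← Finset.sum_filter_add_sum_filter_not Finset.univ (fun x : _ × _ => x.1 < x.2)]
    congr 1
    symm
    refine Finset.sum_subset (fun x => ?_) fun x hx hx' => ?_
    · simp only [Finset.mem_filter, Finset.mem_univ, true_and]; exact fun h => h.le.not_gt
    · simp only [Finset.mem_filter, Finset.mem_univ, true_and, not_lt] at hx hx'
      have : x.1 = x.2 := le_antisymm hx' hx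
      simp [hF, this]
  have h4 : ∑ x, F x = (2 : ℝ) • (∑ i, t i • (θ i * θ i) - (∑ i, t i • θ i) * ∑ i, t i • θ i) := by
    have e1 : ∑ x : Fin (r + 1) × Fin (r + 1), (t x.1 * t x.2) • (θ x.1 * θ x.1) =
        ∑ i, t i • (θ i * θ i) := by
      rw [Fintype.sum_prod_type]
      refine Finset.sum_congr rfl fun i _ => ?_
      dsimp only
      rw [← Finset.sum_smul, ← Finset.mul_sum, ht, mul_one]
    have e2 : ∑ x : Fin (r + 1) × Fin (r + 1), (t x.1 * t x.2) • (θ x.2 * θ x.2) =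
        ∑ i, t i • (θ i * θ i) := by
      rw [Fintype.sum_prod_type, Finset.sum_comm]
      refine Finset.sum_congr rfl fun i _ => ?_
      dsimp only
      rw [← Finset.sum_smul, ← Finset.sum_mul, ht, one_mul]
    have e3 : ∑ x : Fin (r + 1) × Fin (r + 1), (t x.1 * t x.2) • (θ x.1 * θ x.2) =
        (∑ i, t i • θ i) * ∑ i, t i • θ i := by
      rw [Finset.sum_mul_sum, Fintype.sum_prod_type]
      simp only [smul_mul_smul_comm]
    have e4 : ∑ x : Fin (r + 1) × Fin (r + 1), (t x.1 * t x.2) • (θ x.2 * θ x.1) =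
        (∑ i, t i • θ i) * ∑ i, t i • θ i := by
      rw [← e3, ← (Equiv.prodComm _ _).sum_comp]
      refine Finset.sum_congr rfl fun x _ => ?_
      simp [mul_comm]
    have e5 : ∀ x, F x = (t x.1 * t x.2) • (θ x.1 * θ x.1) + (t x.1 * t x.2) • (θ x.2 * θ x.2) -
        (t x.1 * t x.2) • (θ x.1 * θ x.2) - (t x.1 * t x.2) • (θ x.2 * θ x.1) := fun x => by
      simp only [hF, ← smul_add, ← smul_sub]
      congr 1
      noncomm_ring
    simp only [e5, Finset.sum_sub_distrib, Finset.sum_add_distrib, e1, e2, e3, e4]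
    module
  rw [h3, h2, ← two_smul ℝ] at h4
  exact h1.trans (smul_right_injective R (two_ne_zero (α := ℝ)) h4)

theorem sum_fun_eq_sum_perm {β : Type*} [AddCommMonoid β] {k : ℕ} (F : (Fin k → Fin k) → β)
    (hF : ∀ f, ¬ Function.Injective f → F f = 0) :
    ∑ f, F f = ∑ σ : Equiv.Perm (Fin k), F σ := by
  classical
  symm
  refine Finset.sum_of_injOn (fun σ => (σ : Fin k → Fin k)) ?_ ?_ ?_ ?_
  · intro σ _ τ _ h
    exact Equiv.ext (congrFun h)
  · simp
  · intro f _ hf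
    refine hF f fun hi => hf ?_
    exact ⟨Equiv.ofBijective f (Finite.injective_iff_bijective.1 hi), by simp, rfl⟩
  · intros; rfl

theorem add_pow_of_mul_mul_eq_zero {R : Type*} [Ring R] {a b : R} (h : ∀ z, a * z * a = 0) (p : ℕ) :
    (a + b) ^ p = b ^ p + ∑ i ∈ Finset.range p, b ^ i * a * b ^ (p - 1 - i) := by
  induction p with
  | zero => simp
  | succ p ih =>
    -- Expanding with the new factor on the left, every term with a second `a` is killed.
    have h0 : a * ∑ i ∈ Finset.range p, b ^ i * a * b ^ (p - 1 - i) = 0 := by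
      rw [Finset.mul_sum]
      refine Finset.sum_eq_zero fun i _ => ?_
      rw [← mul_assoc, ← mul_assoc, h, zero_mul]
    rw [pow_succ', ih, add_mul, mul_add, h0, mul_add, ← pow_succ', Finset.mul_sum,
      Finset.sum_range_succ' (n := p)]
    simp only [pow_zero, one_mul, Nat.add_sub_cancel, Nat.sub_zero, add_zero]
    rw [add_comm (a * b ^ p), add_assoc]
    congr 2
    refine Finset.sum_congr rfl fun i _ => ?_
    rw [← mul_assoc, ← mul_assoc, ← pow_succ']
    congr 2
    omega

end Identities

/-! ### Traces with exterior coefficients, cyclicity and scaling -/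

section Trace

open scoped TensorProduct

variable {n : ℕ} {M V : Type*} [AddCommGroup M] [Module ℝ M] [AddCommGroup V] [Module ℝ V]

/-- The functional `a ⊗ u ↦ φ(u) tr(a)` on matrices with entries in the exterior algebra. -/
def extTrace (n : ℕ) (φ : ExteriorAlgebra ℝ M →ₗ[ℝ] ℝ) :
    Mat n ⊗[ℝ] ExteriorAlgebra ℝ M →ₗ[ℝ] ℂ :=
  TensorProduct.lift ((LinearMap.lsmul ℝ ℂ ∘ₗ φ).flip ∘ₗ Matrix.traceLinearMap (Fin n) ℝ ℂ)

theorem extTrace_tmul (φ : ExteriorAlgebra ℝ M →ₗ[ℝ] ℝ) (a : Mat n) (u : ExteriorAlgebra ℝ M) :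
    extTrace n φ (a ⊗ₜ u) = φ u • a.trace := by
  simp [extTrace]

theorem extTrace_one_tmul_mul (φ : ExteriorAlgebra ℝ M →ₗ[ℝ] ℝ) (u : ExteriorAlgebra ℝ M)
    (z : Mat n ⊗[ℝ] ExteriorAlgebra ℝ M) :
    extTrace n φ ((1 ⊗ₜ u) * z) = extTrace n (φ ∘ₗ LinearMap.mulLeft ℝ u) z := by
  induction z using TensorProduct.induction_on with
  | zero => simp
  | tmul a u' => rw [Algebra.TensorProduct.tmul_mul_tmul, extTrace_tmul, extTrace_tmul]; simp
  | add z z' hz hz' => rw [mul_add, map_add, map_add, hz, hz']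

/-- The scalar matrix with entry `z`, as a constant in the exterior algebra. -/
def extScalar (n : ℕ) (M : Type*) [AddCommGroup M] [Module ℝ M] (z : ℂ) :
    Mat n ⊗[ℝ] ExteriorAlgebra ℝ M := (z • (1 : Mat n)) ⊗ₜ 1

theorem commute_extScalar (z : ℂ) (x : Mat n ⊗[ℝ] ExteriorAlgebra ℝ M) :
    Commute (extScalar n M z) x := by
  induction x using TensorProduct.induction_on with
  | zero => exact Commute.zero_right _
  | tmul a u => simp [Commute, SemiconjBy, extScalar]
  | add x y hx hy => exact hx.add_right hy

theorem extTrace_extScalar_mul (φ : ExteriorAlgebra ℝ M →ₗ[ℝ] ℝ) (z : ℂ)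
    (x : Mat n ⊗[ℝ] ExteriorAlgebra ℝ M) :
    extTrace n φ (extScalar n M z * x) = z * extTrace n φ x := by
  induction x using TensorProduct.induction_on with
  | zero => simp
  | tmul a u => simp [extScalar, extTrace_tmul]; ring
  | add x y hx hy => rw [mul_add, map_add, map_add, hx, hy, mul_add]

theorem extTrace_extScalar_mul_pow (φ : ExteriorAlgebra ℝ M →ₗ[ℝ] ℝ) (z : ℂ)
    (x : Mat n ⊗[ℝ] ExteriorAlgebra ℝ M) (p : ℕ) :
    extTrace n φ ((extScalar n M z * x) ^ p) = z ^ p * extTrace n φ (x ^ p) := by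
  rw [(commute_extScalar z x).mul_pow]
  generalize x ^ p = y
  induction p generalizing y with
  | zero => simp
  | succ p ih => rw [pow_succ', mul_assoc, extTrace_extScalar_mul, ih, pow_succ', mul_assoc]

/-- The tensor product is over `ℝ`, so a complex factor has to be carried by a scalar matrix. -/
theorem hatDeg_complex_smul {N : ℕ} (v : Fin N → V) (e : Fin N → M) (k : ℕ) (z : ℂ)
    (ω : V [⋀^Fin k]→ₗ[ℝ] Mat n) :
    hatDeg v e k (z • ω) = extScalar n M z * hatDeg v e k ω := by
  simp only [hatDeg, mul_smul_comm, Finset.mul_sum, extScalar, Algebra.TensorProduct.tmul_mul_tmul,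
    one_mul, AlternatingMap.smul_apply, smul_mul_assoc]

/-- If `φ` vanishes in all degrees but `N`, then `extTrace n φ` evaluates forms at `v`. -/
theorem extTrace_hat {N : ℕ} (φ : ExteriorAlgebra ℝ M →ₗ[ℝ] ℝ)
    (hφ : ∀ k ≠ N, ∀ x : Fin k → M, φ (ExteriorAlgebra.ιMulti ℝ k x) = 0)
    (v : Fin N → V) (e : Fin N → M) (ω : Forms V (Mat n)) :
    extTrace n φ (hat v e ω) = φ (ExteriorAlgebra.ιMulti ℝ N e) • (ω N v).trace := by
  have h0 : ∀ k ≠ N, extTrace n φ (hatDeg v e k (ω k)) = 0 := fun k hk => by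
    simp [hatDeg, extTrace_tmul, hφ k hk]
  rw [hat, map_sum, Finset.sum_eq_single_of_mem N (by simp) fun k _ hk => h0 k hk, hatDeg,
    map_smul, map_sum, sum_fun_eq_sum_perm]
  · have h1 : ∀ σ : Equiv.Perm (Fin N), extTrace n φ
        (ω N (fun i => v (σ i)) ⊗ₜ[ℝ] ExteriorAlgebra.ιMulti ℝ N fun i => e (σ i)) =
        φ (ExteriorAlgebra.ιMulti ℝ N e) • (ω N v).trace := by
      intro σ
      rw [extTrace_tmul]
      have e1 := (ω N).map_perm v σ
      have e2 := (ExteriorAlgebra.ιMulti ℝ N).map_perm e σ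
      simp only [Function.comp_def] at e1 e2
      rw [e1, e2]
      rcases Int.units_eq_one_or (Equiv.Perm.sign σ) with h | h <;> simp [h]
    rw [Finset.sum_congr rfl fun σ _ => h1 σ, Finset.sum_const, Finset.card_univ,
      Fintype.card_perm, Fintype.card_fin, ← Nat.cast_smul_eq_nsmul ℝ, smul_smul,
      one_div, inv_mul_cancel₀ (by positivity), one_smul]
  · intro f hf
    rw [ExteriorAlgebra.ιMulti_eq_zero_of_not_inj, TensorProduct.tmul_zero, map_zero]
    exact fun h => hf fun a b hab => h (by simp [hab])

/-- `x` may be moved cyclically under the trace. -/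
def TraceCommutes (φ : ExteriorAlgebra ℝ M →ₗ[ℝ] ℝ) (x : Mat n ⊗[ℝ] ExteriorAlgebra ℝ M) : Prop :=
  ∀ z, extTrace n φ (x * z) = extTrace n φ (z * x)

namespace TraceCommutes

variable {φ : ExteriorAlgebra ℝ M →ₗ[ℝ] ℝ} {x y : Mat n ⊗[ℝ] ExteriorAlgebra ℝ M}

/-- The exterior factor is central, being a product of two vectors, so cyclicity reduces to that of
the matrix trace. -/
theorem tmul_ι_mul_ι (a : Mat n) (x y : M) :
    TraceCommutes φ (a ⊗ₜ (ExteriorAlgebra.ι ℝ x * ExteriorAlgebra.ι ℝ y)) := by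
  intro z
  induction z using TensorProduct.induction_on with
  | zero => simp
  | tmul b u =>
    rw [Algebra.TensorProduct.tmul_mul_tmul, Algebra.TensorProduct.tmul_mul_tmul, extTrace_tmul,
      extTrace_tmul, (commute_ι_mul_ι x y u).eq, Matrix.trace_mul_comm]
  | add z z' hz hz' => rw [mul_add, add_mul, map_add, map_add, hz, hz']

theorem mul (hx : TraceCommutes φ x) (hy : TraceCommutes φ y) : TraceCommutes φ (x * y) := by
  intro z
  rw [mul_assoc, hx, mul_assoc, hy, mul_assoc]

theorem pow (hx : TraceCommutes φ x) (p : ℕ) : TraceCommutes φ (x ^ p) := by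
  induction p with
  | zero => intro z; simp
  | succ p ih => rw [pow_succ]; exact ih.mul hx

theorem add (hx : TraceCommutes φ x) (hy : TraceCommutes φ y) : TraceCommutes φ (x + y) := by
  intro z
  rw [add_mul, map_add, hx, hy, mul_add, map_add]

theorem smul (c : ℝ) (hx : TraceCommutes φ x) : TraceCommutes φ (c • x) := by
  intro z
  rw [smul_mul_assoc, map_smul, hx, mul_smul_comm, map_smul]

theorem sum {ι : Type*} {s : Finset ι} {x : ι → Mat n ⊗[ℝ] ExteriorAlgebra ℝ M}
    (h : ∀ i ∈ s, TraceCommutes φ (x i)) : TraceCommutes φ (∑ i ∈ s, x i) := by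
  intro z
  rw [Finset.sum_mul, Finset.mul_sum, map_sum, map_sum]
  exact Finset.sum_congr rfl fun i hi => h i hi z

theorem hatOne_mul_hatOne {N : ℕ} (v : Fin N → V) (e : Fin N → M) (α β : V →ₗ[ℝ] Mat n) :
    TraceCommutes φ (hatOne v e α * hatOne v e β) := by
  rw [hatOne, hatOne, Finset.sum_mul_sum]
  refine sum fun i _ => sum fun j _ => ?_
  rw [Algebra.TensorProduct.tmul_mul_tmul]
  exact tmul_ι_mul_ι _ _ _

theorem extOne_mul_hatOne {N : ℕ} (v : Fin N → V) (e : Fin N → M) (x : M) (α : V →ₗ[ℝ] Mat n) :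
    TraceCommutes φ (extOne (Mat n) x * hatOne v e α) := by
  rw [hatOne, Finset.mul_sum]
  refine sum fun i _ => ?_
  rw [extOne, Algebra.TensorProduct.tmul_mul_tmul]
  exact tmul_ι_mul_ι _ _ _

end TraceCommutes

/-- If `a z a = 0` for all `z`, then only the terms linear in `a` survive besides `b ^ p`. -/
theorem extTrace_add_pow {φ : ExteriorAlgebra ℝ M →ₗ[ℝ] ℝ} {a b : Mat n ⊗[ℝ] ExteriorAlgebra ℝ M}
    (h : ∀ z, a * z * a = 0) (hb : TraceCommutes φ b) (p : ℕ) :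
    extTrace n φ ((a + b) ^ p) =
      extTrace n φ (b ^ p) + (p : ℝ) • extTrace n φ (a * b ^ (p - 1)) := by
  rw [add_pow_of_mul_mul_eq_zero h, map_add, map_sum]
  congr 1
  have h1 : ∀ i ∈ Finset.range p, extTrace n φ (b ^ i * a * b ^ (p - 1 - i)) =
      extTrace n φ (a * b ^ (p - 1)) := by
    intro i hi
    rw [Finset.mem_range] at hi
    rw [mul_assoc, hb.pow i, mul_assoc, ← pow_add]
    congr 3
    omega
  rw [Finset.sum_congr rfl h1, Finset.sum_const, Finset.card_range, Nat.cast_smul_eq_nsmul]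

/-- The top degree coefficient on the exterior algebra of `ℝ^N`. -/
def topCoeff (N : ℕ) : ExteriorAlgebra ℝ (Fin N → ℝ) →ₗ[ℝ] ℝ :=
  ExteriorAlgebra.liftAlternating
    (Pi.single (M := fun k : ℕ => (Fin N → ℝ) [⋀^Fin k]→ₗ[ℝ] ℝ) N Matrix.detRowAlternating)

theorem topCoeff_ιMulti {N : ℕ} (x : Fin N → Fin N → ℝ) :
    topCoeff N (ExteriorAlgebra.ιMulti ℝ N x) = (Matrix.of x).det := by
  rw [topCoeff, ExteriorAlgebra.liftAlternating_apply_ιMulti, Pi.single_eq_same]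
  rfl

theorem topCoeff_ιMulti_of_ne {N k : ℕ} (hk : k ≠ N) (x : Fin k → Fin N → ℝ) :
    topCoeff N (ExteriorAlgebra.ιMulti ℝ k x) = 0 := by
  rw [topCoeff, ExteriorAlgebra.liftAlternating_apply_ιMulti, Pi.single_eq_of_ne hk]
  rfl

/-- The linear map of `ℝ^N` scaling the coordinates by `d`. -/
def scale {N : ℕ} (d : Fin N → ℝ) : (Fin N → ℝ) →ₗ[ℝ] (Fin N → ℝ) :=
  LinearMap.pi fun j => d j • LinearMap.proj j

theorem topCoeff_map_scale {N : ℕ} (d : Fin N → ℝ) (u : ExteriorAlgebra ℝ (Fin N → ℝ)) :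
    topCoeff N (ExteriorAlgebra.map (scale d) u) = (∏ j, d j) * topCoeff N u := by
  have h : topCoeff N ∘ₗ (ExteriorAlgebra.map (scale d)).toLinearMap = (∏ j, d j) • topCoeff N := by
    refine ExteriorAlgebra.lhom_ext fun k => ?_
    ext x
    simp only [LinearMap.compAlternatingMap_apply, LinearMap.comp_apply, AlgHom.toLinearMap_apply,
      ExteriorAlgebra.map_apply_ιMulti, LinearMap.smul_apply, smul_eq_mul]
    by_cases hk : k = N
    · subst hk
      rw [topCoeff_ιMulti, topCoeff_ιMulti, ← Matrix.det_mul_row]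
      rfl
    · rw [topCoeff_ιMulti_of_ne hk, topCoeff_ιMulti_of_ne hk, mul_zero]
  exact LinearMap.congr_fun h u

/-- The algebra map of `A ⊗ Λ(ℝ^N)` induced by scaling. -/
def scaleHom (n : ℕ) {N : ℕ} (d : Fin N → ℝ) :
    Mat n ⊗[ℝ] ExteriorAlgebra ℝ (Fin N → ℝ) →ₐ[ℝ] Mat n ⊗[ℝ] ExteriorAlgebra ℝ (Fin N → ℝ) :=
  Algebra.TensorProduct.map (AlgHom.id ℝ (Mat n)) (ExteriorAlgebra.map (scale d))

theorem extTrace_scaleHom {N : ℕ} (d : Fin N → ℝ)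
    (z : Mat n ⊗[ℝ] ExteriorAlgebra ℝ (Fin N → ℝ)) :
    extTrace n (topCoeff N) (scaleHom n d z) = (∏ j, d j) • extTrace n (topCoeff N) z := by
  induction z using TensorProduct.induction_on with
  | zero => simp
  | tmul a u =>
    rw [scaleHom, Algebra.TensorProduct.map_tmul, extTrace_tmul, extTrace_tmul, topCoeff_map_scale,
      mul_smul]
    rfl
  | add z z' hz hz' => rw [map_add, map_add, map_add, hz, hz', smul_add]

theorem scaleHom_extOne {N : ℕ} (d : Fin N → ℝ) (x : Fin N → ℝ) :
    scaleHom n d (extOne (Mat n) x) = extOne (Mat n) (scale d x) := by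
  simp [scaleHom, extOne]

theorem scaleHom_hatOne {N m : ℕ} (d : Fin N → ℝ) (v : Fin m → V) (e : Fin m → Fin N → ℝ)
    (α : V →ₗ[ℝ] Mat n) :
    scaleHom n d (hatOne v e α) = hatOne v (fun j => scale d (e j)) α := by
  simp [scaleHom, hatOne]

theorem map_wordSum {R S : Type*} [Ring R] [Ring S] (Φ : R →+* S) (k q : ℕ) (a b : R) :
    Φ (wordSum k q a b) = wordSum k q (Φ a) (Φ b) := by
  rw [wordSum, map_sum, wordSum]
  refine Finset.sum_congr rfl fun f _ => ?_
  rw [map_list_prod, List.map_map]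
  congr 2
  funext x
  rcases x with s | j <;> rfl

theorem wordSum_smul_left {R : Type*} [Ring R] [Algebra ℝ R] (c : ℝ) (k q : ℕ) (a b : R) :
    wordSum k q (c • a) b = c ^ k • wordSum k q a b := by
  rw [wordSum, wordSum, Finset.smul_sum]
  refine Finset.sum_congr rfl fun f _ => ?_
  rw [prod_placementWord, prod_placementWord, ← mul_smul_comm]
  congr 1
  generalize (fun s : Fin k => gapCount f (s + 1)) = h
  have : ∀ (k : ℕ) (g : Fin k → ℕ), (List.ofFn fun s => c • a * b ^ g s).prod =
      c ^ k • (List.ofFn fun s => a * b ^ g s).prod := by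
    intro k g
    induction k with
    | zero => simp
    | succ k ih =>
      rw [List.ofFn_succ, List.ofFn_succ, List.prod_cons, List.prod_cons, ih, smul_mul_assoc,
        smul_mul_smul_comm, pow_succ']
  exact this k _

end Trace

/-! ### Extracting the terms of full degree along the simplex -/

section Frame

open scoped TensorProduct

variable {n k m : ℕ} {W : Type*} [AddCommGroup W] [Module ℝ W]

/-- The basis vectors of `ℝ^(r+m)` belonging to the simplex directions. -/
def simplexVec (r m : ℕ) (i : Fin r) : Fin (r + m) → ℝ := Pi.single (Fin.castAdd m i) 1

/-- The basis vectors of `ℝ^(r+m)` belonging to the directions of `X`. -/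
def baseVec (r m : ℕ) (j : Fin m) : Fin (r + m) → ℝ := Pi.single (Fin.natAdd r j) 1

theorem topCoeff_basis (N : ℕ) :
    topCoeff N (ExteriorAlgebra.ιMulti ℝ N fun j => Pi.single j 1) = 1 := by
  rw [topCoeff_ιMulti]
  have : (Matrix.of fun j : Fin N => (Pi.single j 1 : Fin N → ℝ)) = 1 := by
    ext i j
    simp [Matrix.one_apply, Pi.single_apply, eq_comm]
  rw [this, Matrix.det_one]

theorem append_simplexVec_baseVec (r m : ℕ) :
    Fin.append (simplexVec r m) (baseVec r m) = fun j => Pi.single j 1 := by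
  funext j
  refine Fin.addCases (fun i => ?_) (fun i => ?_) j <;> simp [simplexVec, baseVec]

/-- Multiplying by all simplex directions leaves room only for degree `m` in the directions of `w`.
This converts the algebraic result back into values of forms. -/
theorem extTrace_simplexVec_mul_hat (r : ℕ) (w : Fin m → W) (ω : Forms W (Mat n)) :
    extTrace n (topCoeff (r + m))
      ((1 ⊗ₜ ExteriorAlgebra.ιMulti ℝ r (simplexVec r m)) * hat w (baseVec r m) ω) =
      (ω m w).trace := by
  rw [extTrace_one_tmul_mul, extTrace_hat]
  · simp only [LinearMap.comp_apply, LinearMap.mulLeft_apply]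
    rw [ExteriorAlgebra.ιMulti_mul_ιMulti, append_simplexVec_baseVec, topCoeff_basis, one_smul]
  · intro l hl x
    simp only [LinearMap.comp_apply, LinearMap.mulLeft_apply]
    rw [ExteriorAlgebra.ιMulti_mul_ιMulti]
    exact topCoeff_ιMulti_of_ne (by omega) _

/-- The factors scaling the simplex directions by `2`. -/
def doubling (r m : ℕ) : Fin (r + m) → ℝ := Fin.append (fun _ => 2) (fun _ => 1)

theorem scale_simplexVec (r m : ℕ) (i : Fin r) :
    scale (doubling r m) (simplexVec r m i) = (2 : ℝ) • simplexVec r m i := by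
  funext j
  refine Fin.addCases (fun l => ?_) (fun l => ?_) j
  · by_cases h : l = i
    · simp [scale, doubling, simplexVec, h]
    · simp [scale, doubling, simplexVec, h]
  · have h : Fin.natAdd r l ≠ Fin.castAdd m i := fun h => by
      have := congrArg Fin.val h
      simp only [Fin.val_natAdd, Fin.val_castAdd] at this
      omega
    simp [scale, simplexVec, h]

theorem scale_baseVec (r m : ℕ) (i : Fin m) :
    scale (doubling r m) (baseVec r m i) = baseVec r m i := by
  funext j
  refine Fin.addCases (fun l => ?_) (fun l => ?_) j
  · have h : Fin.castAdd m l ≠ Fin.natAdd r i := fun h => by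
      have := congrArg Fin.val h
      simp only [Fin.val_natAdd, Fin.val_castAdd] at this
      omega
    simp [scale, baseVec, h]
  · by_cases h : l = i
    · simp [scale, doubling, baseVec, h]
    · simp [scale, doubling, baseVec, h]

theorem prod_doubling (r m : ℕ) : ∏ j, doubling r m j = 2 ^ r := by
  simp [doubling, Fin.prod_univ_add]

/-- The partial sums `∑_{l ≥ a} x_l` of the simplex directions. -/
def tailVec (r m : ℕ) (a : Fin r) : Fin (r + m) → ℝ := ∑ l, if a ≤ l then simplexVec r m l else 0

theorem scale_tailVec (r m : ℕ) (a : Fin r) :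
    scale (doubling r m) (tailVec r m a) = (2 : ℝ) • tailVec r m a := by
  rw [tailVec, map_sum, Finset.smul_sum]
  refine Finset.sum_congr rfl fun l _ => ?_
  split_ifs
  · exact scale_simplexVec r m l
  · simp

theorem ιMulti_tailVec (r m : ℕ) :
    ExteriorAlgebra.ιMulti ℝ r (tailVec r m) = ExteriorAlgebra.ιMulti ℝ r (simplexVec r m) :=
  ιMulti_tailSum (simplexVec r m)

theorem extOne_smul {A M : Type*} [Ring A] [Algebra ℝ A] [AddCommGroup M] [Module ℝ M]
    (c : ℝ) (x : M) : extOne A (c • x) = c • extOne A x := by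
  simp [extOne]

/-- Words in `y_s ψ_s` and squares of one-forms: the vectors `y_s` may be collected in front. -/
theorem prod_word_pull_front {A M : Type*} [Ring A] [Algebra ℝ A] [AddCommGroup M] [Module ℝ M]
    {K q : ℕ} (w : Fin m → W) (e : Fin m → M) (L : List (Fin K ⊕ Fin q))
    (hL : L.filterMap Sum.getLeft? = List.finRange K) (y : Fin K → M)
    (α : Fin K → W →ₗ[ℝ] A) (β : Fin q → W →ₗ[ℝ] A) :
    (L.map (Sum.elim (fun s => extOne A (y s) * hatOne w e (α s))
      (fun j => hatOne w e (β j) * hatOne w e (β j)))).prod =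
    (-1) ^ (K * (K - 1) / 2) * ((1 ⊗ₜ ExteriorAlgebra.ιMulti ℝ K y) *
      (L.map (Sum.elim (fun s => hatOne w e (α s))
        (fun j => hatOne w e (β j) * hatOne w e (β j)))).prod) := by
  rw [prod_pull_front (fun i j => hatOne_mul_extOne w e (α i) (y j)) _ L, hL, prod_map_extOne,
    List.length_finRange]
  intro i j
  rw [mul_assoc, hatOne_mul_extOne, mul_neg, ← mul_assoc, hatOne_mul_extOne, neg_mul, neg_neg,
    mul_assoc]

variable {P : Type} [Fintype P]

/-- With more letters than vectors some `y_a` must repeat, and the monomial collected in front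
vanishes. -/
theorem wordSum_eq_zero_of_lt {q k' : ℕ} (hk : k < k') (w : Fin m → W)
    {M : Type*} [AddCommGroup M] [Module ℝ M] (e : Fin m → M) (y : Fin k → M)
    (α : Fin k → W →ₗ[ℝ] Mat n) (β : P → W →ₗ[ℝ] Mat n) (u : P → ℝ) :
    wordSum k' q (∑ a, extOne (Mat n) (y a) * hatOne w e (α a))
      (∑ x, u x • (hatOne w e (β x) * hatOne w e (β x))) = 0 := by
  refine Finset.sum_eq_zero fun f _ => ?_
  rw [prod_map_sum_sum (nodup_placementWord f) (mem_placementWord f)]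
  refine Finset.sum_eq_zero fun τ _ => Finset.sum_eq_zero fun c _ => ?_
  rw [prod_word_pull_front w e _ (filterMap_getLeft_placementWord f) (fun s => y (τ s))
    (fun s => α (τ s)) (fun j => β (c j)), ExteriorAlgebra.ιMulti_eq_zero_of_not_inj,
    TensorProduct.tmul_zero, zero_mul, mul_zero, smul_zero]
  intro h
  have : Function.Injective τ := fun a b hab => h (by simp [hab])
  have := Fintype.card_le_of_injective τ this
  simp at this
  omega

/-- Expanding the letters gives maps `τ`; those repeating a vector vanish, which leaves
permutations. `prod_word_pull_front` applied to all `k + 1` letters supplies the power of `-1`, and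
sorting the vectors supplies the sign of `σ`. -/
theorem mul_wordSum_eq {q : ℕ} (w : Fin m → W)
    {A M : Type*} [Ring A] [Algebra ℝ A] [AddCommGroup M] [Module ℝ M] (e : Fin m → M) (y : Fin (k + 1) → M)
    (α : Fin (k + 1) → W →ₗ[ℝ] A) (β : P → W →ₗ[ℝ] A) (u : P → ℝ) :
    (extOne A (y 0) * hatOne w e (α 0)) *
      wordSum k q (∑ a : Fin k, extOne A (y a.succ) * hatOne w e (α a.succ))
        (∑ x, u x • (hatOne w e (β x) * hatOne w e (β x))) =
    ∑ σ : Equiv.Perm (Fin k), ∑ f ∈ placements q (k + 1), ∑ c : Fin q → P,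
      (((-1) ^ ((k + 1) * k / 2) * ((Equiv.Perm.sign σ : ℤ) : ℝ)) * ∏ j, u (c j)) •
        ((1 ⊗ₜ ExteriorAlgebra.ιMulti ℝ (k + 1) y) * (hatOne w e (α 0) *
          ((placementWord f).map (Sum.elim (fun s => hatOne w e (α (σ s).succ))
            (fun j => hatOne w e (β (c j)) * hatOne w e (β (c j))))).prod)) := by
  have key : ∀ (f : Fin q → Fin (k + 1)) (τ : Fin k → Fin k) (c : Fin q → P),
      (extOne A (y 0) * hatOne w e (α 0)) *
        ((placementWord f).map (Sum.elim
          (fun s => extOne A (y (τ s).succ) * hatOne w e (α (τ s).succ))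
          (fun j => hatOne w e (β (c j)) * hatOne w e (β (c j))))).prod =
      (-1) ^ ((k + 1) * k / 2) * ((1 ⊗ₜ ExteriorAlgebra.ιMulti ℝ (k + 1)
          (fun i => y ((Fin.cons 0 fun s => (τ s).succ : Fin (k + 1) → Fin (k + 1)) i))) *
        (hatOne w e (α 0) *
          ((placementWord f).map (Sum.elim (fun s => hatOne w e (α (τ s).succ))
            (fun j => hatOne w e (β (c j)) * hatOne w e (β (c j))))).prod)) := by
    intro f τ c
    have h := prod_word_pull_front w e
      (Sum.inl 0 :: (placementWord f).map (Sum.map Fin.succ id)) (by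
        rw [List.filterMap_cons, List.filterMap_map]
        have h1 : (Sum.getLeft? ∘ Sum.map Fin.succ id : Fin k ⊕ Fin q → Option (Fin (k + 1))) =
            fun x => (Sum.getLeft? x).map Fin.succ := by
          funext x; rcases x with x | x <;> rfl
        simp only [Sum.getLeft?_inl]
        rw [h1, ← List.map_filterMap, filterMap_getLeft_placementWord, List.finRange_succ])
      (fun i => y ((Fin.cons 0 fun s => (τ s).succ : Fin (k + 1) → Fin (k + 1)) i))
      (fun i => α ((Fin.cons 0 fun s => (τ s).succ : Fin (k + 1) → Fin (k + 1)) i))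
      (fun j => β (c j))
    simp only [List.map_cons, List.prod_cons, List.map_map, Sum.elim_inl, Fin.cons_zero,
      Sum.elim_comp_map, Function.comp_id, Nat.add_sub_cancel] at h
    simp only [Function.comp_def, Fin.cons_succ] at h
    exact h
  have hsign : ∀ z : A ⊗[ℝ] ExteriorAlgebra ℝ M,
      (-1) ^ ((k + 1) * k / 2) * z = ((-1 : ℝ) ^ ((k + 1) * k / 2)) • z := by
    intro z
    rw [Algebra.smul_def, map_pow, map_neg, map_one]
  rw [wordSum, Finset.mul_sum, Finset.sum_comm]
  refine Finset.sum_congr rfl fun f _ => ?_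
  rw [prod_map_sum_sum (nodup_placementWord f) (mem_placementWord f), Finset.mul_sum,
    sum_fun_eq_sum_perm]
  · refine Finset.sum_congr rfl fun σ _ => ?_
    rw [Finset.mul_sum]
    refine Finset.sum_congr rfl fun c _ => ?_
    rw [mul_smul_comm, key, hsign, smul_smul, mul_comm (∏ j, u (c j)), mul_assoc, mul_smul,
      mul_smul]
    congr 1
    rw [mul_comm ((Equiv.Perm.sign σ : ℤ) : ℝ), mul_smul]
    congr 1
    -- The order of the vectors is the permutation fixing `0` and acting as `σ` on the successors;
    -- its sign is that of `σ`.
    have h1 : (Fin.cons 0 fun s => (σ s).succ : Fin (k + 1) → Fin (k + 1)) =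
        Equiv.Perm.decomposeFin.symm (0, σ) := by
      funext i
      refine Fin.cases ?_ (fun i => ?_) i <;> simp
    have h2 := (ExteriorAlgebra.ιMulti ℝ (M := M) (k + 1)).map_perm y
      (Equiv.Perm.decomposeFin.symm (0, σ))
    rw [Equiv.Perm.decomposeFin.symm_sign, if_pos rfl, one_mul] at h2
    rw [h1]
    change (1 ⊗ₜ[ℝ] ExteriorAlgebra.ιMulti ℝ (k + 1) (y ∘ _)) * _ = _
    rw [h2]
    rcases Int.units_eq_one_or (Equiv.Perm.sign σ) with h | h <;>
      simp [h, TensorProduct.tmul_neg]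
  · intro τ hτ
    rw [Finset.mul_sum]
    refine Finset.sum_eq_zero fun c _ => ?_
    rw [mul_smul_comm, key, ExteriorAlgebra.ιMulti_eq_zero_of_not_inj, TensorProduct.tmul_zero,
      zero_mul, mul_zero, smul_zero]
    intro h
    refine hτ fun a b hab => ?_
    have := @h a.succ b.succ (by simp [hab])
    exact Fin.succ_injective _ this

/-- Scaling detects the degree in the simplex directions: the top coefficient has weight `2^a`, so
an element of weight `2^b` with `b ≠ a` cannot contribute. -/
theorem extTrace_eq_zero_of_scaleHom {N a b : ℕ} {d : Fin N → ℝ} (hd : ∏ j, d j = 2 ^ a)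
    (hab : b ≠ a) {z : Mat n ⊗[ℝ] ExteriorAlgebra ℝ (Fin N → ℝ)}
    (hz : scaleHom n d z = (2 : ℝ) ^ b • z) : extTrace n (topCoeff N) z = 0 := by
  have h := extTrace_scaleHom d z
  rw [hz, map_smul, hd, ← sub_eq_zero, ← sub_smul] at h
  refine (smul_eq_zero.1 h).resolve_left fun h0 => hab ?_
  exact Nat.pow_right_injective le_rfl (by
    have := sub_eq_zero.1 h0
    exact_mod_cast this)

theorem extTrace_pow_eq {q p : ℕ} (hp : p = q + (k + 1)) (w : Fin m → W)
    (α : Fin (k + 1) → W →ₗ[ℝ] Mat n) (β : P → W →ₗ[ℝ] Mat n) (u : P → ℝ) :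
    extTrace n (topCoeff (k + 1 + m))
      ((∑ a, extOne (Mat n) (tailVec (k + 1) m a) * hatOne w (baseVec (k + 1) m) (α a) +
        ∑ x, u x • (hatOne w (baseVec (k + 1) m) (β x) * hatOne w (baseVec (k + 1) m) (β x))) ^ p) =
    (p : ℝ) • ∑ σ : Equiv.Perm (Fin k), ∑ f ∈ placements q (k + 1), ∑ c : Fin q → P,
      (((-1) ^ ((k + 1) * k / 2) * ((Equiv.Perm.sign σ : ℤ) : ℝ)) * ∏ j, u (c j)) •
        extTrace n (topCoeff (k + 1 + m))
        ((1 ⊗ₜ ExteriorAlgebra.ιMulti ℝ (k + 1) (simplexVec (k + 1) m)) *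
          (hatOne w (baseVec (k + 1) m) (α 0) *
          ((placementWord f).map (Sum.elim (fun s => hatOne w (baseVec (k + 1) m) (α (σ s).succ))
            (fun j => hatOne w (baseVec (k + 1) m) (β (c j)) *
              hatOne w (baseVec (k + 1) m) (β (c j))))).prod)) := by
  set e := baseVec (k + 1) m
  set y := tailVec (k + 1) m with hy
  set φ := topCoeff (k + 1 + m)
  set d := doubling (k + 1) m
  set a₀ := extOne (Mat n) (y 0) * hatOne w e (α 0) with ha₀
  set a' := ∑ a : Fin k, extOne (Mat n) (y a.succ) * hatOne w e (α a.succ) with ha'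
  set b := ∑ x, u x • (hatOne w e (β x) * hatOne w e (β x)) with hb
  have hscale : ∀ γ : W →ₗ[ℝ] Mat n, scaleHom n d (hatOne w e γ) = hatOne w e γ := fun γ => by
    rw [scaleHom_hatOne]
    congr 1
    funext j
    exact scale_baseVec _ _ j
  have hletter : ∀ a, scaleHom n d (extOne (Mat n) (y a) * hatOne w e (α a)) =
      (2 : ℝ) • (extOne (Mat n) (y a) * hatOne w e (α a)) := fun a => by
    rw [map_mul, hscale, scaleHom_extOne, scale_tailVec, extOne_smul, smul_mul_assoc]
  have hb_scale : scaleHom n d b = b := by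
    simp only [hb, map_sum, map_smul, map_mul, hscale]
  have ha_scale : scaleHom n d a' = (2 : ℝ) • a' := by
    simp only [ha', map_sum, hletter, Finset.smul_sum]
  have hword : ∀ k' q', scaleHom n d (wordSum k' q' a' b) = (2 : ℝ) ^ k' • wordSum k' q' a' b := by
    intro k' q'
    have := map_wordSum (scaleHom n d).toRingHom k' q' a' b
    change scaleHom n d _ = wordSum k' q' (scaleHom n d a') (scaleHom n d b) at this
    rw [this, ha_scale, hb_scale, wordSum_smul_left]
  have hsq : ∀ z, a₀ * z * a₀ = 0 := fun z => by
    have := extOne_mul_mul_extOne (A := Mat n) (y 0) (hatOne w e (α 0) * z)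
    rw [ha₀]
    calc _ = (extOne (Mat n) (y 0) * (hatOne w e (α 0) * z) * extOne (Mat n) (y 0)) *
        hatOne w e (α 0) := by noncomm_ring
      _ = 0 := by rw [this, zero_mul]
  have hcomm : TraceCommutes φ (a' + b) :=
    (TraceCommutes.sum fun a _ => TraceCommutes.extOne_mul_hatOne _ _ _ _).add
      (TraceCommutes.sum fun x _ => (TraceCommutes.hatOne_mul_hatOne _ _ _ _).smul _)
  -- Without `a₀` only `k` of the vectors `y` are available, while degree `k + 1` along the simplex
  -- is required.
  have hzero : extTrace n φ ((a' + b) ^ p) = 0 := by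
    rw [add_pow_eq_sum_wordSum, map_sum]
    refine Finset.sum_eq_zero fun x _ => ?_
    by_cases hx : x.1 = k + 1
    · rw [hx, ha', hb, wordSum_eq_zero_of_lt (Nat.lt_succ_self k) w e (fun a => y a.succ)
        (fun a => α a.succ) β u, map_zero]
    · exact extTrace_eq_zero_of_scaleHom (prod_doubling _ _) hx (hword _ _)
  -- The factor `a₀` has simplex degree one, so exactly `k` more letters from `a'` are needed; the
  -- exponent `p - 1 = k + q` then forces `q` squares.
  have hlin : extTrace n φ (a₀ * (a' + b) ^ (p - 1)) = extTrace n φ (a₀ * wordSum k q a' b) := by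
    rw [add_pow_eq_sum_wordSum, Finset.mul_sum, map_sum]
    refine Finset.sum_eq_single_of_mem (k, q) ?_ ?_
    · rw [Finset.HasAntidiagonal.mem_antidiagonal]
      simp only
      omega
    · rintro ⟨k', q'⟩ hx hne
      rw [Finset.HasAntidiagonal.mem_antidiagonal] at hx
      have hk' : k' ≠ k := by
        rintro rfl
        refine hne ?_
        simp only at hx
        rw [Prod.mk.injEq]
        omega
      refine extTrace_eq_zero_of_scaleHom (prod_doubling _ _) (b := k' + 1) (by omega) ?_
      rw [map_mul, hword, hletter, smul_mul_smul_comm, pow_succ']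
  rw [Fin.sum_univ_succ, add_assoc (extOne _ _ * _), extTrace_add_pow hsq hcomm, hzero, zero_add, hlin, ha₀, ha', hb,
    mul_wordSum_eq, hy, ιMulti_tailVec]
  simp only [map_sum, map_smul]

end Frame

/-! ### The curvature as a sum of letters -/

section Curvature

open scoped TensorProduct

variable {r m : ℕ} {A X : Type*} [Ring A] [Algebra ℝ A] [AddCommGroup X] [Module ℝ X]

/-- The tangent vectors of `Δ^r × X` at which a form of bidegree `(r, m)` is evaluated. -/
def productFrame (r : ℕ) (w : Fin m → X) : Fin (r + m) → (Fin r → ℝ) × X :=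
  Fin.append (fun i : Fin r => ((Pi.single i 1, 0) : (Fin r → ℝ) × X)) (fun j => (0, w j))

theorem hatOne_comp_snd (w : Fin m → X) (α : X →ₗ[ℝ] A) :
    hatOne (productFrame r w) (fun j => (Pi.single j 1 : Fin (r + m) → ℝ))
      (α ∘ₗ LinearMap.snd ℝ (Fin r → ℝ) X) = hatOne w (baseVec r m) α := by
  simp [hatOne, Fin.sum_univ_add, productFrame, baseVec]

/-- A constant scalar `1`-form on the simplex, as an `A`-valued form on `Δ^r × X`. -/
def simplexForm (A X : Type*) [Ring A] [Algebra ℝ A] [AddCommGroup X] [Module ℝ X]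
    (l : (Fin r → ℝ) →ₗ[ℝ] ℝ) : (Fin r → ℝ) × X →ₗ[ℝ] A :=
  (l ∘ₗ LinearMap.fst ℝ (Fin r → ℝ) X).smulRight 1

theorem hatOne_simplexForm (w : Fin m → X) (l : (Fin r → ℝ) →ₗ[ℝ] ℝ) :
    hatOne (productFrame r w) (fun j => (Pi.single j 1 : Fin (r + m) → ℝ)) (simplexForm A X l) =
      extOne A (∑ i, l (Pi.single i 1) • simplexVec r m i) := by
  simp [hatOne, Fin.sum_univ_add, productFrame, simplexForm, extOne, simplexVec,
    TensorProduct.tmul_sum, TensorProduct.smul_tmul]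

/-- Eliminates `dt_0 = -(dt_1 + … + dt_r)` from `∑ dt_i θ_i`. -/
theorem sum_baryDiff_mul (x : Fin r → A) (θ : Fin (r + 1) → A) :
    ∑ i, (∑ l, baryDiff r i (Pi.single l 1) • x l) * θ i = -∑ l, x l * (θ 0 - θ l.succ) := by
  rw [Fin.sum_univ_succ]
  have h0 : ∀ l : Fin r, baryDiff r 0 (Pi.single l 1) = -1 := fun l => by
    simp [baryDiff_zero_apply]
  have h1 : ∀ i : Fin r, ∑ l, baryDiff r i.succ (Pi.single l 1) • x l = x i := fun i => by
    simp [baryDiff_succ_apply, Pi.single_apply]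
  simp only [h0, h1, mul_sub, Finset.sum_sub_distrib, neg_smul, one_smul, Finset.sum_neg_distrib,
    neg_mul, Finset.sum_mul]
  abel

theorem sum_bary (t : Fin r → ℝ) : ∑ i, bary t i = 1 := by
  simp [bary, Fin.sum_univ_succ]

theorem hatDeg_two_of_curvature (w : Fin m → X) (t : Fin r → ℝ) (θ : Fin (r + 1) → X →ₗ[ℝ] A)
    (ω : ((Fin r → ℝ) × X) [⋀^Fin 2]→ₗ[ℝ] A)
    (h : ∀ a b, ω ![a, b] =
      ∑ i, (baryDiff r i a.1 • θ i b.2 - baryDiff r i b.1 • θ i a.2) -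
      ∑ i, bary t i • (θ i a.2 * θ i b.2 - θ i b.2 * θ i a.2) +
      ((∑ i, bary t i • θ i a.2) * (∑ i, bary t i • θ i b.2) -
        (∑ i, bary t i • θ i b.2) * (∑ i, bary t i • θ i a.2))) :
    hatDeg (productFrame r w) (fun j => (Pi.single j 1 : Fin (r + m) → ℝ)) 2 ω =
      -(∑ a : Fin r, extOne A (tailVec r m a) *
          hatOne w (baseVec r m) (θ a.castSucc - θ a.succ) +
        ∑ x : Pairs r, (bary t x.1.1 * bary t x.1.2) •
          (hatOne w (baseVec r m) (θ x.1.1 - θ x.1.2) *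
            hatOne w (baseVec r m) (θ x.1.1 - θ x.1.2))) := by
  set e := fun j => (Pi.single j 1 : Fin (r + m) → ℝ)
  set H : (X →ₗ[ℝ] A) →ₗ[ℝ] A ⊗[ℝ] ExteriorAlgebra ℝ (Fin (r + m) → ℝ) :=
    { toFun := hatOne w (baseVec r m)
      map_add' := fun α β => by simp [hatOne, TensorProduct.add_tmul, Finset.sum_add_distrib]
      map_smul' := fun c α => by simp [hatOne, TensorProduct.smul_tmul', Finset.smul_sum] } with hH
  have hHa : ∀ α, hatOne w (baseVec r m) α = H α := fun _ => rfl
  -- The three blocks of summands are `dt_i ∧ θ_i`, `-t_i θ_i²` and the square of the whole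
  -- connection form.
  have h1 := hatDeg_two (productFrame r w) e
    (Finset.univ : Finset (Fin (r + 1) ⊕ Fin (r + 1) ⊕ Unit))
    (Sum.elim (fun _ => 1) (Sum.elim (fun i => -bary t i) fun _ => 1))
    (Sum.elim (fun i => simplexForm A X (baryDiff r i).toLinearMap)
      (Sum.elim (fun i => θ i ∘ₗ LinearMap.snd ℝ (Fin r → ℝ) X)
        fun _ => (∑ i, bary t i • θ i) ∘ₗ LinearMap.snd ℝ (Fin r → ℝ) X))
    (Sum.elim (fun i => θ i ∘ₗ LinearMap.snd ℝ (Fin r → ℝ) X)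
      (Sum.elim (fun i => θ i ∘ₗ LinearMap.snd ℝ (Fin r → ℝ) X)
        fun _ => (∑ i, bary t i • θ i) ∘ₗ LinearMap.snd ℝ (Fin r → ℝ) X)) ω (by
    intro a b
    rw [h]
    simp [simplexForm, Fintype.sum_sum_type, Finset.sum_sub_distrib, smul_sub]
    abel)
  rw [h1]
  simp only [Fintype.sum_sum_type, Sum.elim_inl, Sum.elim_inr, hatOne_comp_snd, e,
    hatOne_simplexForm, one_smul, Finset.univ_unique, Finset.sum_singleton, hHa, neg_smul,
    Finset.sum_neg_distrib, ContinuousLinearMap.coe_coe]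
  have h2 := sum_baryDiff_mul (fun l => extOne A (simplexVec r m l)) (fun i => H (θ i))
  have h3 := sum_mul_sub_eq_tailSum (fun l => extOne A (simplexVec r m l)) (fun i => H (θ i))
  have h4 := sum_pairs_sq (bary t) (sum_bary t) (fun i => H (θ i))
  have h5 : ∀ a : Fin r, (∑ l, if a ≤ l then extOne A (simplexVec r m l) else 0) =
      extOne A (tailVec r m a) := fun a => by
    rw [tailVec, extOne_sum]
    refine Finset.sum_congr rfl fun l _ => ?_
    split_ifs
    · rfl
    · simp [extOne]
  simp only [h5] at h3
  simp only [map_sub, map_sum, map_smul, h4, ← h3, neg_add, ← h2, extOne_sum, extOne_smul]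
  abel

end Curvature

/-! ### The Chern form and its integral over the simplex -/

section ChernForm

open scoped TensorProduct

variable {n r m p q k : ℕ}

theorem hat_stepForm (g : NBar n r) (w : Fin m → NBar n r) (a : Fin r) :
    hat w (baseVec r m) (stepForm g a) = hatOne w (baseVec r m)
      ((theta a.castSucc g).toLinearMap - (theta a.succ g).toLinearMap) :=
  hat_oneForm _ _ _

theorem hat_squareForm (g : NBar n r) (w : Fin m → NBar n r) (x : Pairs r) :
    hat w (baseVec r m) (squareForm g x) =
      hatOne w (baseVec r m) ((theta x.1.1 g).toLinearMap - (theta x.1.2 g).toLinearMap) *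
      hatOne w (baseVec r m) ((theta x.1.1 g).toLinearMap - (theta x.1.2 g).toLinearMap) := by
  rw [squareForm, hat_wedge]
  congr 1 <;> exact hat_oneForm _ _ _

theorem insertedProd_eq (g : NBar n (k + 1)) (σ : Equiv.Perm (Fin k)) (f : Fin q → Fin (k + 1))
    (c : Fin q → Pairs (k + 1)) :
    insertedProd g σ f c = wedgeProd ((placementWord f).map
      (Sum.elim (fun s => stepForm g (σ s).succ) (fun j => squareForm g (c j)))) := by
  rw [insertedProd, placementWord, List.map_append, List.map_flatMap, List.map_map]
  simp only [List.map_cons, List.map_map]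
  rfl

theorem hat_insertedProd (g : NBar n (k + 1)) (w : Fin m → NBar n (k + 1))
    (σ : Equiv.Perm (Fin k)) (f : Fin q → Fin (k + 1)) (c : Fin q → Pairs (k + 1)) :
    hat w (baseVec (k + 1) m) (insertedProd g σ f c) = ((placementWord f).map
      (Sum.elim (fun s => hat w (baseVec (k + 1) m) (stepForm g (σ s).succ))
        (fun j => hat w (baseVec (k + 1) m) (squareForm g (c j))))).prod := by
  rw [insertedProd_eq, hat_wedgeProd, List.map_map]
  congr 2
  funext x
  rcases x with s | j <;> rfl

theorem hatDeg_curvature (g : Fin (r + 1) → GL (Fin n) ℂ) (w : Fin m → NBar n r)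
    (t : Fin r → ℝ) :
    hatDeg (productFrame r w) (fun j => (Pi.single j 1 : Fin (r + m) → ℝ)) 2
      (curvature n r (t, fun i => (g i : Mat n))) =
      -(∑ a : Fin r, extOne (Mat n) (tailVec r m a) *
          hat w (baseVec r m) (stepForm (fun i => (g i : Mat n)) a) +
        ∑ x : Pairs r, (bary t x.1.1 * bary t x.1.2) •
          hat w (baseVec r m) (squareForm (fun i => (g i : Mat n)) x)) := by
  simp only [hat_stepForm, hat_squareForm]
  exact hatDeg_two_of_curvature w t (fun i => (theta i (fun i => (g i : Mat n))).toLinearMap)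
    (curvature n r (t, fun i => (g i : Mat n))) (curvature_apply g t)

theorem simplexCoeff_chernForm_eq_extTrace (g : Fin (r + 1) → GL (Fin n) ℂ)
    (w : Fin m → NBar n r) (t : Fin r → ℝ) :
    simplexCoeff (chernForm n r p) m (fun i => (g i : Mat n)) w t =
      (1 / (p.factorial : ℂ)) * ((1 / (2 * (Real.pi : ℂ) * Complex.I)) ^ p *
        extTrace n (topCoeff (r + m))
          ((∑ a : Fin r, extOne (Mat n) (tailVec r m a) *
              hat w (baseVec r m) (stepForm (fun i => (g i : Mat n)) a) +
            ∑ x : Pairs r, (bary t x.1.1 * bary t x.1.2) •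
              hat w (baseVec r m) (squareForm (fun i => (g i : Mat n)) x)) ^ p)) := by
  set e := fun j => (Pi.single j 1 : Fin (r + m) → ℝ)
  set z : ℂ := -1 / (2 * (Real.pi : ℂ) * Complex.I) with hz
  set Ω := curvature n r (t, fun i => (g i : Mat n))
  have h1 : simplexCoeff (chernForm n r p) m (fun i => (g i : Mat n)) w t =
      (1 / (p.factorial : ℂ)) *
        (wedgePow (z • homog 2 Ω) p (r + m) (productFrame r w)).trace := rfl
  have h2 := extTrace_hat (n := n) (topCoeff (r + m)) (fun k hk x => topCoeff_ιMulti_of_ne hk x)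
    (productFrame r w) e (wedgePow (z • homog 2 Ω) p)
  rw [topCoeff_basis, one_smul] at h2
  have h3 : z • homog 2 Ω = homog 2 (z • Ω) := by
    funext j
    by_cases hj : j = 2
    · subst hj; simp [homog]
    · simp [homog, Pi.single_eq_of_ne hj]
  rw [h1, ← h2, hat_wedgePow, h3, hat_homog, hatDeg_complex_smul, extTrace_extScalar_mul_pow,
    hatDeg_curvature]
  -- The minus sign in front of the curvature letters cancels the one in `-Ω / 2πi`.
  have h4 : ∀ x : Mat n ⊗[ℝ] ExteriorAlgebra ℝ (Fin (r + m) → ℝ),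
      z ^ p * extTrace n (topCoeff (r + m)) ((-x) ^ p) =
        (-z) ^ p * extTrace n (topCoeff (r + m)) (x ^ p) := by
    intro x
    rw [← extTrace_extScalar_mul_pow, ← extTrace_extScalar_mul_pow]
    congr 2
    refine (neg_mul_comm (extScalar n _ z) x).symm.trans (congrArg (· * x) ?_)
    rw [extScalar, extScalar, neg_smul]
    exact (TensorProduct.neg_tmul _ _).symm
  rw [h4, hz, neg_div, neg_neg]

theorem prod_comp_eq_prod_pow_multiplicity (u : Pairs r → ℝ) (c : Fin q → Pairs r) :
    ∏ j, u (c j) = ∏ x, u x ^ multiplicity c x := by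
  rw [← Finset.prod_fiberwise' Finset.univ c u]
  simp [multiplicity]

theorem simplexCoeff_chernForm (hp : p = q + (k + 1)) (g : Fin (k + 2) → GL (Fin n) ℂ)
    (w : Fin m → NBar n (k + 1)) (t : Fin (k + 1) → ℝ) :
    simplexCoeff (chernForm n (k + 1) p) m (fun i => (g i : Mat n)) w t =
      ((1 / (p.factorial : ℂ)) * (1 / (2 * (Real.pi : ℂ) * Complex.I)) ^ p *
        (-1) ^ ((k + 1) * k / 2)) *
      ∑ σ : Equiv.Perm (Fin k), ∑ f ∈ placements q (k + 1), ∑ c : Fin q → Pairs (k + 1),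
        ((((Equiv.Perm.sign σ : ℤ) : ℝ) *
          ∏ x : Pairs (k + 1), (bary t x.1.1 * bary t x.1.2) ^ multiplicity c x : ℝ) : ℂ) *
        traceForm (wedge ((p : ℝ) • stepForm (fun i => (g i : Mat n)) 0)
          (insertedProd (fun i => (g i : Mat n)) σ f c)) m w := by
  -- The explicit forms are written in the same algebra, so that the comparison becomes one of
  -- coefficients.
  have hT : ∀ (σ : Equiv.Perm (Fin k)) (f : Fin q → Fin (k + 1)) (c : Fin q → Pairs (k + 1)),
      traceForm (wedge ((p : ℝ) • stepForm (fun i => (g i : Mat n)) 0)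
          (insertedProd (fun i => (g i : Mat n)) σ f c)) m w =
      (p : ℝ) • extTrace n (topCoeff (k + 1 + m))
        ((1 ⊗ₜ ExteriorAlgebra.ιMulti ℝ (k + 1) (simplexVec (k + 1) m)) *
          (hat w (baseVec (k + 1) m) (stepForm (fun i => (g i : Mat n)) 0) *
          hat w (baseVec (k + 1) m) (insertedProd (fun i => (g i : Mat n)) σ f c))) := by
    intro σ f c
    refine (extTrace_simplexVec_mul_hat (k + 1) w _).symm.trans ?_
    rw [hat_wedge, hat_smul, smul_mul_assoc, mul_smul_comm, map_smul]
  rw [simplexCoeff_chernForm_eq_extTrace]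
  simp only [hT, hat_insertedProd, hat_stepForm, hat_squareForm]
  rw [extTrace_pow_eq hp w
    (fun a => (theta a.castSucc (fun i => (g i : Mat n))).toLinearMap -
      (theta a.succ (fun i => (g i : Mat n))).toLinearMap)
    (fun x : Pairs (k + 1) => (theta x.1.1 (fun i => (g i : Mat n))).toLinearMap -
      (theta x.1.2 (fun i => (g i : Mat n))).toLinearMap)
    (fun x => bary t x.1.1 * bary t x.1.2)]
  rw [← mul_assoc, mul_assoc _ ((-1 : ℂ) ^ _)]
  congr 1
  simp only [Finset.smul_sum, Finset.mul_sum]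
  refine Finset.sum_congr rfl fun σ _ => Finset.sum_congr rfl fun f _ =>
    Finset.sum_congr rfl fun c _ => ?_
  rw [prod_comp_eq_prod_pow_multiplicity (fun x => bary t x.1.1 * bary t x.1.2)]
  simp only [Complex.real_smul]
  push_cast
  ring

theorem isCompact_simplex (r : ℕ) : IsCompact (simplex r) := by
  refine (isCompact_Icc (a := (0 : Fin r → ℝ)) (b := 1)).of_isClosed_subset ?_ ?_
  · have : simplex r = (⋂ i, {t | 0 ≤ t i}) ∩ {t | ∑ i, t i ≤ 1} := by
      ext t; simp [simplex]
    rw [this]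
    refine IsClosed.inter (isClosed_iInter fun i => ?_) ?_
    · exact isClosed_le continuous_const (continuous_apply i)
    · exact isClosed_le (by fun_prop) continuous_const
  · rintro t ⟨h0, h1⟩
    refine ⟨h0, fun i => ?_⟩
    exact (Finset.single_le_sum (fun j _ => h0 j) (Finset.mem_univ i)).trans h1

theorem continuous_bary (i : Fin (r + 1)) : Continuous fun t : Fin r → ℝ => bary t i := by
  refine Fin.cases ?_ (fun j => ?_) i
  · simp only [bary, Fin.cons_zero]; fun_prop
  · simp only [bary, Fin.cons_succ]; fun_prop

theorem integrableOn_simplex_prod (c : Fin q → Pairs r) :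
    MeasureTheory.IntegrableOn (fun t => ∏ x : Pairs r, (bary t x.1.1 * bary t x.1.2) ^
      multiplicity c x) (simplex r) := by
  refine ContinuousOn.integrableOn_compact (isCompact_simplex r) (Continuous.continuousOn ?_)
  exact continuous_finsetProd _ fun x _ => ((continuous_bary _).mul (continuous_bary _)).pow _

theorem traceForm_sum_apply {V ι : Type*} [AddCommGroup V] [Module ℝ V] (s : Finset ι)
    (F : ι → Forms V (Mat n)) (v : Fin m → V) :
    traceForm (∑ i ∈ s, F i) m v = ∑ i ∈ s, traceForm (F i) m v := by
  let T : Forms V (Mat n) →+ ℂ :=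
    { toFun := fun ω => traceForm ω m v
      map_zero' := by simp [traceForm]
      map_add' := fun ω η => by simp [traceForm] }
  exact map_sum T F s

theorem traceForm_smul_apply {V : Type*} [AddCommGroup V] [Module ℝ V] (c : ℝ)
    (ω : Forms V (Mat n)) (v : Fin m → V) :
    traceForm (c • ω) m v = (c : ℂ) * traceForm ω m v := by
  simp [traceForm]

/-- For fixed `g` and `w` the integrand is a finite sum of polynomials in `t` times constants, so
integrability and the value follow term by term. -/
theorem integral_chernForm (hp : p = q + (k + 1)) (g : Fin (k + 2) → GL (Fin n) ℂ)
    (w : Fin m → NBar n (k + 1)) :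
    MeasureTheory.IntegrableOn
      (simplexCoeff (chernForm n (k + 1) p) m (fun i => (g i : Mat n)) w) (simplex (k + 1)) ∧
    integrateSimplex (chernForm n (k + 1) p) m (fun i => (g i : Mat n)) w =
      (((1 / (p.factorial : ℂ)) * (1 / (2 * (Real.pi : ℂ) * Complex.I)) ^ p *
          (-1) ^ ((k + 1) * k / 2)) •
        traceForm (∑ σ : Equiv.Perm (Fin k), ∑ f ∈ placements q (k + 1),
          ∑ c : Fin q → Pairs (k + 1),
            (((Equiv.Perm.sign σ : ℤ) : ℝ) * simplexIntegral c) •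
              wedge ((p : ℝ) • stepForm (fun i => (g i : Mat n)) 0)
                (insertedProd (fun i => (g i : Mat n)) σ f c))) m w := by
  have hint : ∀ (σ : Equiv.Perm (Fin k)) (c : Fin q → Pairs (k + 1)) (z : ℂ),
      MeasureTheory.IntegrableOn (fun t : Fin (k + 1) → ℝ => ((((Equiv.Perm.sign σ : ℤ) : ℝ) *
          ∏ x : Pairs (k + 1), (bary t x.1.1 * bary t x.1.2) ^ multiplicity c x : ℝ) : ℂ) * z)
        (simplex (k + 1)) := fun σ c z =>
    (((integrableOn_simplex_prod c).const_mul _).ofReal (𝕜 := ℂ)).mul_const z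
  have hval : ∀ (σ : Equiv.Perm (Fin k)) (c : Fin q → Pairs (k + 1)) (z : ℂ),
      ∫ t in simplex (k + 1), ((((Equiv.Perm.sign σ : ℤ) : ℝ) *
          ∏ x : Pairs (k + 1), (bary t x.1.1 * bary t x.1.2) ^ multiplicity c x : ℝ) : ℂ) * z =
        ((((Equiv.Perm.sign σ : ℤ) : ℝ) * simplexIntegral c : ℝ) : ℂ) * z := fun σ c z => by
    rw [MeasureTheory.integral_mul_const, integral_complex_ofReal,
      MeasureTheory.integral_const_mul, simplexIntegral]
  have hfun := funext fun t => simplexCoeff_chernForm hp g w t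
  constructor
  · rw [hfun]
    refine MeasureTheory.Integrable.const_mul ?_ _
    exact MeasureTheory.integrable_finsetSum _ fun σ _ =>
      MeasureTheory.integrable_finsetSum _ fun f _ =>
      MeasureTheory.integrable_finsetSum _ fun c _ => hint σ c _
  · rw [integrateSimplex, hfun, MeasureTheory.integral_const_mul]
    rw [MeasureTheory.integral_finsetSum _ fun σ _ =>
      MeasureTheory.integrable_finsetSum _ fun f _ =>
      MeasureTheory.integrable_finsetSum _ fun c _ => hint σ c _]
    change _ = _ * traceForm _ m w
    congr 1
    rw [traceForm_sum_apply]
    refine Finset.sum_congr rfl fun σ _ => ?_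
    rw [traceForm_sum_apply, MeasureTheory.integral_finsetSum _ fun f _ =>
      MeasureTheory.integrable_finsetSum _ fun c _ => hint σ c _]
    refine Finset.sum_congr rfl fun f _ => ?_
    rw [traceForm_sum_apply, MeasureTheory.integral_finsetSum _ fun c _ => hint σ c _]
    refine Finset.sum_congr rfl fun c _ => ?_
    rw [traceForm_smul_apply, hval]

theorem integral_chernForm_of_pos (hr : 0 < r) (hp : p = q + r) (g : Fin (r + 1) → GL (Fin n) ℂ)
    (w : Fin m → NBar n r) :
    MeasureTheory.IntegrableOn
      (simplexCoeff (chernForm n r p) m (fun i => (g i : Mat n)) w) (simplex r) ∧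
    integrateSimplex (chernForm n r p) m (fun i => (g i : Mat n)) w =
      (((1 / (p.factorial : ℂ)) * (1 / (2 * (Real.pi : ℂ) * Complex.I)) ^ p *
          (-1) ^ (r * (r - 1) / 2)) •
        traceForm (∑ σ : Equiv.Perm (Fin (r - 1)), ∑ f ∈ placements q r,
          ∑ c : Fin q → Pairs r,
            (((Equiv.Perm.sign σ : ℤ) : ℝ) * simplexIntegral c) •
              wedge ((p : ℝ) • stepForm (fun i => (g i : Mat n)) ⟨0, hr⟩)
                (insertedProd (fun i => (g i : Mat n)) σ f c))) m w := by
  obtain ⟨k, rfl⟩ := Nat.exists_eq_succ_of_ne_zero hr.ne'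
  exact integral_chernForm hp g w

end ChernForm

end SimplicialChern

end

open SimplicialChern in
theorem theorem3p1 (n p q : ℕ) (hq : q < p) (g : Fin (p - q + 1) → GL (Fin n) ℂ)
    (w : Fin (p + q) → NBar n (p - q)) :
    MeasureTheory.IntegrableOn
      (simplexCoeff (chernForm n (p - q) p) (p + q) (fun i => (g i : Mat n)) w)
      (simplex (p - q)) ∧
    integrateSimplex (chernForm n (p - q) p) (p + q) (fun i => (g i : Mat n)) w =
      (((1 / (p.factorial : ℂ)) * (1 / (2 * (Real.pi : ℂ) * Complex.I)) ^ p *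
          (-1) ^ ((p - q) * (p - q - 1) / 2)) •
        traceForm (∑ σ : Equiv.Perm (Fin (p - q - 1)), ∑ f ∈ placements q (p - q),
          ∑ c : Fin q → Pairs (p - q),
            (((Equiv.Perm.sign σ : ℤ) : ℝ) * simplexIntegral c) •
              wedge ((p : ℝ) • stepForm (fun i => (g i : Mat n)) ⟨0, Nat.sub_pos_of_lt hq⟩)
                (insertedProd (fun i => (g i : Mat n)) σ f c))) (p + q) w :=
  integral_chernForm_of_pos (Nat.sub_pos_of_lt hq) (by omega) g w
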